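/- For $s,t,u\in\mathbb C$ consider the forms of degree $6$, $2$ and $6$ in the homogeneous coordinates $(x:y:z:w)$ of $\mathbb P^3=\mathbb P^3(\mathbb C)$ given by \[ p=\frac z{16}\Bigl[x\bigl(x^4-2\cdot5\,x^2y^2+5\,y^4\bigr)-5z\,(x^2+y^2)^2+4\cdot5\,z^3(x^2+y^2)-16\,z^5\Bigr], \] \[ q_{s,t,u}=s\,(x^2+y^2)+t\,z^2+u\,zw+w^2,\qquad f_{s,t,u}=p-q_{s,t,u}^3 . \] The equation \[ 2^{15}\cdot 3^3\, s^6-2^6\cdot 3^3\cdot 5\, s^3+5^2=0 \] has exactly six complex roots, none of them real. Let $s_0\in\mathbb C$ be any of these roots and put \[ t_0=-4\,s_0\left(\frac{2^7\cdot 3^2}{5}\,s_0^3+1\right). \] Then the sextic surface $\{f_{s_0,t_0,0}=0\}\subset\mathbb P^3$ has exactly $35$ singular points. All of them are of type $A_2$ (cusps), that is, in suitable local holomorphic coordinates the surface is given near each of them by $x^3+y^2+z^2=0$. The total Milnor number of the surface, i.e. the sum over its singular points of the Milnor numbers of its local equations, is $70$. -/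

import Mathlib

open MvPolynomial

noncomputable section

/-- The sextic form `p`, the product of the plane `z` and of the five planes
`cos (2πj/5) x + sin (2πj/5) y - z`, in expanded form.
The homogeneous coordinates `x, y, z, w` are `X 0, X 1, X 2, X 3`. -/
def planesForm : MvPolynomial (Fin 4) ℂ :=
  C (1 / 16) * X 2 *
    (X 0 * (X 0 ^ 4 - C (2 * 5) * X 0 ^ 2 * X 1 ^ 2 + C 5 * X 1 ^ 4)
      - C 5 * X 2 * (X 0 ^ 2 + X 1 ^ 2) ^ 2
      + C (4 * 5) * X 2 ^ 3 * (X 0 ^ 2 + X 1 ^ 2)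
      - C 16 * X 2 ^ 5)

/-- The quadratic form `q_{s,t,u,v} = s (x² + y²) + t z² + u z w + v w²`. -/
def quadricForm (s t u v : ℂ) : MvPolynomial (Fin 4) ℂ :=
  C s * (X 0 ^ 2 + X 1 ^ 2) + C t * X 2 ^ 2 + C u * (X 2 * X 3) + C v * X 3 ^ 2

/-- The four-parameter family of sextic forms `f_{s,t,u,v} = p - q_{s,t,u,v}³`. -/
def sexticForm₄ (s t u v : ℂ) : MvPolynomial (Fin 4) ℂ :=
  planesForm - quadricForm s t u v ^ 3

/-- The three-parameter family `f_{s,t,u} = f_{s,t,u,1}`. -/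
def sexticForm (s t u : ℂ) : MvPolynomial (Fin 4) ℂ :=
  sexticForm₄ s t u 1

/-- Complex projective three-space. -/
abbrev P3 : Type := Projectivization ℂ (Fin 4 → ℂ)

/-- The singular points of the surface `F = 0` in projective three-space, for a form `F`
(vanishing of `F` and of its partial derivatives does not depend on the representative). -/
def singularPoints (F : MvPolynomial (Fin 4) ℂ) : Set P3 :=
  {P | eval P.rep F = 0 ∧ ∀ i, eval P.rep (pderiv i F) = 0}

open Classical in
/-- The index of the last nonzero homogeneous coordinate of `P`. It selects a standard affine
chart containing `P`. -/
def chartIndex (P : P3) : Fin 4 :=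
  (Finset.univ.filter fun i => P.rep i ≠ 0).max' (by
    obtain ⟨i, hi⟩ := Function.ne_iff.mp P.rep_nonzero
    exact ⟨i, by simpa using hi⟩)

/-- The dehomogenization of `F`: the `i`-th variable is set to `1`, the other three are kept in
their order. -/
def dehomogenize (F : MvPolynomial (Fin 4) ℂ) (i : Fin 4) : MvPolynomial (Fin 3) ℂ :=
  aeval (i.insertNth (1 : MvPolynomial (Fin 3) ℂ) X) F

/-- The coordinates of `P` in the `i`-th standard affine chart (for `P` in this chart). -/
def affineCoord (P : P3) (i : Fin 4) : Fin 3 → ℂ :=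
  fun k => P.rep (i.succAbove k) / P.rep i

/-- The function `g` on affine three-space has at `a` a singularity of type `A_k` (`k ≥ 1`): in
suitable local holomorphic coordinates `Φ` centred at `a` it is `x^(k+1) + y² + z²`. -/
def IsTypeA (k : ℕ) (g : MvPolynomial (Fin 3) ℂ) (a : Fin 3 → ℂ) : Prop :=
  ∃ Φ : (Fin 3 → ℂ) → (Fin 3 → ℂ), ∃ L : (Fin 3 → ℂ) ≃L[ℂ] (Fin 3 → ℂ),
    AnalyticAt ℂ Φ a ∧ Φ a = 0 ∧ HasFDerivAt Φ (L : (Fin 3 → ℂ) →L[ℂ] (Fin 3 → ℂ)) a ∧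
    ∀ᶠ x in nhds a, eval x g = Φ x 0 ^ (k + 1) + Φ x 1 ^ 2 + Φ x 2 ^ 2

/-- The maximal ideal of the point `a` of affine three-space. -/
abbrev pointIdeal (a : Fin 3 → ℂ) : Ideal (MvPolynomial (Fin 3) ℂ) :=
  RingHom.ker (aeval a : MvPolynomial (Fin 3) ℂ →ₐ[ℂ] ℂ)

instance pointIdeal_isPrime (a : Fin 3 → ℂ) : (pointIdeal a).IsPrime :=
  RingHom.ker_isPrime _

/-- The local ring of affine three-space at the point `a`. -/
abbrev LocalRingAt (a : Fin 3 → ℂ) : Type :=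
  Localization.AtPrime (pointIdeal a)

/-- The Jacobian ideal of `g` in the local ring at `a`. -/
def jacobianIdeal (g : MvPolynomial (Fin 3) ℂ) (a : Fin 3 → ℂ) : Ideal (LocalRingAt a) :=
  Ideal.span (Set.range fun i =>
    algebraMap (MvPolynomial (Fin 3) ℂ) (LocalRingAt a) (pderiv i g))

/-- The Milnor number of `g` at `a`: the complex dimension of the local ring modulo the Jacobian
ideal (with value `⊤` if it is infinite). -/
def affineMilnorNumber (g : MvPolynomial (Fin 3) ℂ) (a : Fin 3 → ℂ) : ℕ∞ :=
  Cardinal.toENat (Module.rank ℂ (LocalRingAt a ⧸ jacobianIdeal g a))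

/-- The surface `F = 0` has at its point `P` a singularity of type `A_k`. -/
def HasTypeA (k : ℕ) (F : MvPolynomial (Fin 4) ℂ) (P : P3) : Prop :=
  IsTypeA k (dehomogenize F (chartIndex P)) (affineCoord P (chartIndex P))

/-- The Milnor number of the surface `F = 0` at its point `P`. -/
def milnorNumber (F : MvPolynomial (Fin 4) ℂ) (P : P3) : ℕ∞ :=
  affineMilnorNumber (dehomogenize F (chartIndex P)) (affineCoord P (chartIndex P))

/-- The total Milnor number of the surface `F = 0`: the sum of the Milnor numbers at its singular
points. -/
def totalMilnorNumber (F : MvPolynomial (Fin 4) ℂ) : ℕ∞ :=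
  ∑' P : singularPoints F, milnorNumber F P

/-- The sextic equation `2¹⁵ 3³ s⁶ - 2⁶ 3³ 5 s³ + 5² = 0` for the parameter `s`. -/
def IsSpecialParameter (s : ℂ) : Prop :=
  2 ^ 15 * 3 ^ 3 * s ^ 6 - 2 ^ 6 * 3 ^ 3 * 5 * s ^ 3 + 5 ^ 2 = 0

end

/-! The six planes of `p` all pass through (0:0:0:1) and meet in pairs along 15 distinct lines. At a
point with q = 0 the gradient of q³ vanishes, so the surface p = q³ is singular there exactly when p
is, that is, on one of these lines. Since u = 0 and the parameters are special, each line meets q =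
0 in two distinct points, neither of them the common vertex. Near such a point p is, up to units, a
sum of two squares of local parameters, and q is a third parameter. This gives 30 cusps.

At a singular point with q ≠ 0 the w-derivative forces w = 0, leaving a singularity of the plane
curve p = q³ in w = 0. A fifth root of unity rotates it to the axis y = 0, where it becomes a
multiple root of a polynomial in one variable. With d = 9216 s³/5 - 9 the sextic equation for s
reads d² = -15. For the special t this polynomial has a triple root at (7 - d)/2 and no other
relevant multiple root. The surface is nondegenerate in the directions y and w there, so the five
rotated points are cusps too.

`IsSingularVector.exists_rotVector` reduces all singular points to seven representatives modulo
rotation, and `rotVector_injective` shows that the 5 · 7 points are distinct. `IsCuspForm` is a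
polynomial certificate u₀L₀³ + u₁L₁² + u₂L₂² yielding both the analytic type A₂ and the Milnor
number 2. It is exhibited for each kind of point by the lemmas `isCuspForm_of_...`. -/

/-! ### Milnor number of a cusp certificate -/

theorem span_range_mulVec {A : Type*} [CommRing A] {n : ℕ} (M : Matrix (Fin n) (Fin n) A)
    (hM : IsUnit M.det) (v : Fin n → A) :
    Ideal.span (Set.range (M.mulVec v)) = Ideal.span (Set.range v) := by
  have key : ∀ (N : Matrix (Fin n) (Fin n) A) (u : Fin n → A),
      Ideal.span (Set.range (N.mulVec u)) ≤ Ideal.span (Set.range u) := by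
    intro N u
    rw [Ideal.span_le]
    rintro _ ⟨i, rfl⟩
    exact Ideal.sum_mem (Ideal.span (Set.range u)) (t := Finset.univ) (f := fun j => N i j * u j)
      fun j _ => Ideal.mul_mem_left (Ideal.span (Set.range u)) (N i j)
        (Ideal.subset_span (Set.mem_range_self j))
  refine le_antisymm (key M v) ?_
  have h := key M⁻¹ (M.mulVec v)
  rwa [Matrix.mulVec_mulVec, Matrix.nonsing_inv_mul _ hM, Matrix.one_mulVec] at h

/-- Hadamard's lemma for polynomials; by the next lemma the cofactors take the values of the partial
derivatives at `a`. -/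
theorem exists_eq_sum_mul_X_sub_C (a : Fin 3 → ℂ) (f : MvPolynomial (Fin 3) ℂ) :
    ∃ g : Fin 3 → MvPolynomial (Fin 3) ℂ, f = C (eval a f) + ∑ i, g i * (X i - C (a i)) := by
  induction f using MvPolynomial.induction_on with
  | C c => exact ⟨0, by simp⟩
  | add p q hp hq =>
    obtain ⟨g, hg⟩ := hp
    obtain ⟨k, hk⟩ := hq
    refine ⟨g + k, ?_⟩
    conv_lhs => rw [hg, hk]
    simp only [map_add, Pi.add_apply, add_mul, Finset.sum_add_distrib]
    ring
  | mul_X p i hp =>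
    obtain ⟨g, hg⟩ := hp
    refine ⟨fun j => g j * X i + if j = i then C (eval a p) else 0, ?_⟩
    conv_lhs => rw [hg]
    simp only [map_mul, eval_X, add_mul, Finset.sum_add_distrib, Finset.sum_mul, ite_mul, zero_mul,
      Finset.sum_ite_eq', Finset.mem_univ, if_true]
    have h : ∑ j, g j * X i * (X j - C (a j)) = ∑ j, g j * (X j - C (a j)) * X i :=
      Finset.sum_congr rfl fun j _ => by ring
    rw [h]
    ring

theorem eval_of_eq_sum_mul_X_sub_C (a : Fin 3 → ℂ) (f : MvPolynomial (Fin 3) ℂ) (c : ℂ)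
    (g : Fin 3 → MvPolynomial (Fin 3) ℂ) (h : f = C c + ∑ i, g i * (X i - C (a i)))
    (j : Fin 3) : eval a (g j) = eval a (pderiv j f) := by
  rw [h]
  simp [Derivation.leibniz, pderiv_X, Pi.single_apply, apply_ite (eval a)]

/-- Data of an `A₂` singularity of `g` at `a`: `g = u₀ L₀³ + u₁ L₁² + u₂ L₂²`, where the `Lᵢ` are
local parameters at `a` and the `uᵢ` do not vanish at `a`. -/
structure IsCuspForm (u L : Fin 3 → MvPolynomial (Fin 3) ℂ) (g : MvPolynomial (Fin 3) ℂ)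
    (a : Fin 3 → ℂ) : Prop where
  eq : g = u 0 * L 0 ^ 3 + u 1 * L 1 ^ 2 + u 2 * L 2 ^ 2
  unit : ∀ i, eval a (u i) ≠ 0
  zero : ∀ i, eval a (L i) = 0
  det : (Matrix.of fun i j => eval a (pderiv j (L i))).det ≠ 0

theorem isUnit_algebraMap_of_eval_ne_zero {a : Fin 3 → ℂ} {f : MvPolynomial (Fin 3) ℂ}
    (h : eval a f ≠ 0) : IsUnit (algebraMap (MvPolynomial (Fin 3) ℂ) (LocalRingAt a) f) :=
  IsLocalization.map_units (M := (pointIdeal a).primeCompl) (LocalRingAt a)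
    ⟨f, fun hf => h (by simpa [RingHom.mem_ker, aeval_eq_eval] using hf)⟩

theorem isUnit_det_map_of_eval_ne_zero {a : Fin 3 → ℂ}
    {M : Matrix (Fin 3) (Fin 3) (MvPolynomial (Fin 3) ℂ)} (h : (M.map (eval a)).det ≠ 0) :
    IsUnit (M.map (algebraMap (MvPolynomial (Fin 3) ℂ) (LocalRingAt a))).det := by
  have h2 := RingHom.map_det (algebraMap (MvPolynomial (Fin 3) ℂ) (LocalRingAt a)) M
  rw [RingHom.mapMatrix_apply] at h2
  rw [← h2]
  apply isUnit_algebraMap_of_eval_ne_zero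
  have h3 := RingHom.map_det (eval a) M
  rw [RingHom.mapMatrix_apply] at h3
  rwa [h3]

/-- The residue field is ℂ and the maximal ideal is generated by the coordinate differences: for o =
r/s the constant is r(a)/s(a). -/
theorem exists_sub_algebraMap_mem_span (a : Fin 3 → ℂ) (o : LocalRingAt a) :
    ∃ c : ℂ, o - algebraMap ℂ (LocalRingAt a) c ∈ Ideal.span (Set.range fun i =>
      algebraMap (MvPolynomial (Fin 3) ℂ) (LocalRingAt a) (X i - C (a i))) := by
  obtain ⟨r, s, rfl⟩ := IsLocalization.exists_mk'_eq (pointIdeal a).primeCompl o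
  have hs : eval a (s : MvPolynomial (Fin 3) ℂ) ≠ 0 := fun h => s.2 (by
    simpa [RingHom.mem_ker, aeval_eq_eval] using h)
  set c : ℂ := eval a r / eval a (s : MvPolynomial (Fin 3) ℂ) with hc
  obtain ⟨g, hg⟩ := exists_eq_sum_mul_X_sub_C a (r - C c * (s : MvPolynomial (Fin 3) ℂ))
  have h0 : eval a (r - C c * (s : MvPolynomial (Fin 3) ℂ)) = 0 := by
    simp [hc, div_mul_cancel₀ _ hs]
  refine ⟨c, ?_⟩
  obtain ⟨t, ht⟩ := (isUnit_algebraMap_of_eval_ne_zero hs).exists_right_inv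
  rw [h0, map_zero, zero_add] at hg
  have h1 := IsLocalization.mk'_spec (LocalRingAt a) r s
  have h2 := congrArg (algebraMap (MvPolynomial (Fin 3) ℂ) (LocalRingAt a)) hg
  rw [map_sub, map_mul, map_sum] at h2
  have h3 : algebraMap ℂ (LocalRingAt a) c =
      algebraMap (MvPolynomial (Fin 3) ℂ) (LocalRingAt a) (C c) :=
    IsScalarTower.algebraMap_apply ℂ (MvPolynomial (Fin 3) ℂ) (LocalRingAt a) c
  have h4 : IsLocalization.mk' (LocalRingAt a) r s - algebraMap ℂ (LocalRingAt a) c = t *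
      ∑ i, algebraMap (MvPolynomial (Fin 3) ℂ) (LocalRingAt a) (g i * (X i - C (a i))) := by
    rw [h3, ← h2, ← h1]
    linear_combination (-IsLocalization.mk' (LocalRingAt a) r s +
      algebraMap (MvPolynomial (Fin 3) ℂ) (LocalRingAt a) (C c)) * ht
  rw [h4]
  refine Ideal.mul_mem_left _ _ (Ideal.sum_mem _ fun i _ => ?_)
  rw [map_mul]
  exact Ideal.mul_mem_left _ _ (Ideal.subset_span ⟨i, rfl⟩)

/-- The `L i` arise from the coordinate differences by a matrix whose value at `a` is their Jacobian
matrix, hence by a matrix invertible over the local ring. -/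
theorem IsCuspForm.span_parameters {u L : Fin 3 → MvPolynomial (Fin 3) ℂ}
    {g : MvPolynomial (Fin 3) ℂ} {a : Fin 3 → ℂ} (h : IsCuspForm u L g a) :
    Ideal.span (Set.range fun i =>
      algebraMap (MvPolynomial (Fin 3) ℂ) (LocalRingAt a) (L i)) =
    Ideal.span (Set.range fun i =>
      algebraMap (MvPolynomial (Fin 3) ℂ) (LocalRingAt a) (X i - C (a i))) := by
  choose k hk using fun i => exists_eq_sum_mul_X_sub_C a (L i)
  have hM : IsUnit ((Matrix.of k).map
      (algebraMap (MvPolynomial (Fin 3) ℂ) (LocalRingAt a))).det := by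
    apply isUnit_det_map_of_eval_ne_zero
    convert h.det using 2
    ext i j
    exact eval_of_eq_sum_mul_X_sub_C a (L i) _ (k i) (hk i) j
  rw [← span_range_mulVec _ hM fun i =>
    algebraMap (MvPolynomial (Fin 3) ℂ) (LocalRingAt a) (X i - C (a i))]
  congr 2
  funext i
  rw [hk i, h.zero i]
  simp [Matrix.mulVec, dotProduct]

/-- By the product rule the partial derivatives of `g` are combinations of L₀², L₁, L₂. At `a` the
coefficient matrix is the transposed Jacobian matrix of the `L i` with columns scaled by 3u₀, 2u₁,
2u₂, so it is invertible. -/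
theorem IsCuspForm.jacobianIdeal_eq {u L : Fin 3 → MvPolynomial (Fin 3) ℂ}
    {g : MvPolynomial (Fin 3) ℂ} {a : Fin 3 → ℂ} (h : IsCuspForm u L g a) :
    jacobianIdeal g a = Ideal.span (Set.range fun i =>
      algebraMap (MvPolynomial (Fin 3) ℂ) (LocalRingAt a) (![L 0 ^ 2, L 1, L 2] i)) := by
  set M : Matrix (Fin 3) (Fin 3) (MvPolynomial (Fin 3) ℂ) := Matrix.of fun j =>
    ![3 * u 0 * pderiv j (L 0) + L 0 * pderiv j (u 0),
      2 * u 1 * pderiv j (L 1) + L 1 * pderiv j (u 1),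
      2 * u 2 * pderiv j (L 2) + L 2 * pderiv j (u 2)] with hMdef
  have hM : IsUnit (M.map (algebraMap (MvPolynomial (Fin 3) ℂ) (LocalRingAt a))).det := by
    apply isUnit_det_map_of_eval_ne_zero
    have h1 : (M.map (eval a)).det = 12 * eval a (u 0) * eval a (u 1) * eval a (u 2) *
        (Matrix.of fun i j => eval a (pderiv j (L i))).det := by
      simp only [Matrix.det_fin_three, Matrix.map_apply, hMdef, Matrix.of_apply]
      simp [h.zero]
      ring
    rw [h1]
    have h0 := h.unit
    exact mul_ne_zero (mul_ne_zero (mul_ne_zero (mul_ne_zero (by norm_num) (h0 0)) (h0 1)) (h0 2))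
      h.det
  rw [jacobianIdeal, ← span_range_mulVec _ hM fun i =>
    algebraMap (MvPolynomial (Fin 3) ℂ) (LocalRingAt a) (![L 0 ^ 2, L 1, L 2] i)]
  congr 2
  funext j
  rw [h.eq]
  simp only [Matrix.mulVec, dotProduct, Fin.sum_univ_three, Matrix.map_apply, ← map_mul, ← map_add]
  congr 1
  simp [hMdef, Derivation.leibniz, Derivation.leibniz_pow]
  ring

/-- After clearing a denominator m with m(a) ≠ 0, a relation m L₀ = c₀L₀² + c₁L₁ + c₂L₂
differentiates at `a` to a linear dependence among the differentials of the `L i`. -/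
theorem IsCuspForm.notMem_jacobianIdeal {u L : Fin 3 → MvPolynomial (Fin 3) ℂ}
    {g : MvPolynomial (Fin 3) ℂ} {a : Fin 3 → ℂ} (h : IsCuspForm u L g a) :
    algebraMap (MvPolynomial (Fin 3) ℂ) (LocalRingAt a) (L 0) ∉ jacobianIdeal g a := by
  rw [h.jacobianIdeal_eq]
  intro hmem
  have h1 : (Set.range fun i => algebraMap (MvPolynomial (Fin 3) ℂ) (LocalRingAt a)
      (![L 0 ^ 2, L 1, L 2] i)) = algebraMap (MvPolynomial (Fin 3) ℂ) (LocalRingAt a) ''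
      Set.range ![L 0 ^ 2, L 1, L 2] := by
    rw [← Set.range_comp]; rfl
  rw [h1, ← Ideal.map_span,
    IsLocalization.algebraMap_mem_map_algebraMap_iff (pointIdeal a).primeCompl] at hmem
  obtain ⟨m, hm, hmem⟩ := hmem
  have hs : eval a m ≠ 0 := fun h => hm (by simpa [RingHom.mem_ker, aeval_eq_eval] using h)
  rw [Ideal.mem_span_range_iff_exists_fun] at hmem
  obtain ⟨c, hc⟩ := hmem
  apply h.det
  rw [← Matrix.exists_vecMul_eq_zero_iff]
  refine ⟨![eval a m, - eval a (c 1), - eval a (c 2)], fun h0 => hs (by simpa using congrFun h0 0),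
    ?_⟩
  funext j
  have h2 := congrArg (fun f => eval a (pderiv j f)) hc
  simp [Fin.sum_univ_three, Derivation.leibniz, Derivation.leibniz_pow, h.zero] at h2
  simp [Matrix.vecMul, dotProduct, Fin.sum_univ_three]
  linear_combination -h2

theorem IsCuspForm.affineMilnorNumber_eq {u L : Fin 3 → MvPolynomial (Fin 3) ℂ}
    {g : MvPolynomial (Fin 3) ℂ} {a : Fin 3 → ℂ} (h : IsCuspForm u L g a) :
    affineMilnorNumber g a = 2 := by
  set J := jacobianIdeal g a with hJ
  set am := algebraMap (MvPolynomial (Fin 3) ℂ) (LocalRingAt a) with ham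
  have hL : ∀ o : LocalRingAt a, ∃ c : ℂ, o - algebraMap ℂ (LocalRingAt a) c ∈
      Ideal.span (Set.range fun i => am (L i)) := by
    intro o
    rw [h.span_parameters]
    exact exists_sub_algebraMap_mem_span a o
  have hJ' := h.jacobianIdeal_eq
  have m0 : am (L 0) ^ 2 ∈ J := by
    rw [hJ, hJ', ← map_pow]; exact Ideal.subset_span ⟨0, rfl⟩
  have m1 : am (L 1) ∈ J := by rw [hJ, hJ']; exact Ideal.subset_span ⟨1, rfl⟩
  have m2 : am (L 2) ∈ J := by rw [hJ, hJ']; exact Ideal.subset_span ⟨2, rfl⟩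
  -- The classes of 1 and L₀ form a basis of the quotient.
  let φ : ℂ × ℂ →ₗ[ℂ] LocalRingAt a ⧸ J :=
    (J.mkQ.restrictScalars ℂ) ∘ₗ
      (LinearMap.coprod (Algebra.linearMap ℂ (LocalRingAt a))
        (LinearMap.toSpanSingleton ℂ (LocalRingAt a) (am (L 0))))
  have hφ : ∀ p, φ p = Ideal.Quotient.mk J
      (algebraMap ℂ (LocalRingAt a) p.1 + p.2 • am (L 0)) := fun p => rfl
  have hinj : Function.Injective φ := by
    rw [← LinearMap.ker_eq_bot, LinearMap.ker_eq_bot']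
    rintro ⟨c, c'⟩ hp
    rw [hφ, Ideal.Quotient.eq_zero_iff_mem] at hp
    have hmap : ∀ z : ℂ, algebraMap ℂ (LocalRingAt a) z = am (C z) := fun z =>
      IsScalarTower.algebraMap_apply ℂ (MvPolynomial (Fin 3) ℂ) (LocalRingAt a) z
    have hc : c = 0 := by
      by_contra hc
      have hu : IsUnit (am (C c + C c' * L 0)) := isUnit_algebraMap_of_eval_ne_zero (by
        simpa [h.zero] using hc)
      rw [map_add, map_mul, ← hmap, ← hmap, ← Algebra.smul_def] at hu
      have ht : J = ⊤ := J.eq_top_of_isUnit_mem hp hu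
      exact h.notMem_jacobianIdeal (hJ ▸ ht.symm ▸ Submodule.mem_top)
    have hc' : c' = 0 := by
      by_contra hc'
      have hu : IsUnit (am (C c')) := isUnit_algebraMap_of_eval_ne_zero (by simpa using hc')
      simp only [hc, map_zero, zero_add] at hp
      rw [Algebra.smul_def, hmap] at hp
      exact h.notMem_jacobianIdeal ((J.unit_mul_mem_iff_mem hu).1 hp)
    rw [hc, hc']
    rfl
  have hsurj : Function.Surjective φ := by
    intro q
    obtain ⟨o, rfl⟩ := Ideal.Quotient.mk_surjective q
    obtain ⟨c, hc⟩ := hL o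
    obtain ⟨k, hk⟩ := (Ideal.mem_span_range_iff_exists_fun).1 hc
    -- Expanding the coefficient of L₀ once more leaves only a constant multiple of L₀ modulo L₀²,
    -- L₁, L₂.
    obtain ⟨c', hc'⟩ := hL (k 0)
    obtain ⟨k', hk'⟩ := (Ideal.mem_span_range_iff_exists_fun).1 hc'
    refine ⟨(c, c'), ?_⟩
    rw [hφ, eq_comm, Ideal.Quotient.eq]
    rw [Fin.sum_univ_three] at hk hk'
    have e : o - (algebraMap ℂ (LocalRingAt a) c + c' • am (L 0)) =
        k' 0 * am (L 0) ^ 2 + (k' 1 * am (L 0) + k 1) * am (L 1) +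
          (k' 2 * am (L 0) + k 2) * am (L 2) := by
      rw [Algebra.smul_def]
      linear_combination -hk - am (L 0) * hk'
    rw [e]
    exact J.add_mem (J.add_mem (J.mul_mem_left _ m0) (J.mul_mem_left _ m1)) (J.mul_mem_left _ m2)
  have e := (LinearEquiv.ofBijective φ ⟨hinj, hsurj⟩).rank_eq
  rw [affineMilnorNumber, ← hJ, ← e]
  simp
  exact one_add_one_eq_two

/-! ### Analytic normal form of a cusp certificate -/

theorem MvPolynomial.hasFDerivAt_eval (f : MvPolynomial (Fin 3) ℂ) (a : Fin 3 → ℂ) :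
    HasFDerivAt (fun x => eval x f)
      (∑ j, eval a (pderiv j f) • ContinuousLinearMap.proj (R := ℂ) (φ := fun _ : Fin 3 => ℂ) j)
      a := by
  induction f using MvPolynomial.induction_on with
  | C c =>
    simp only [eval_C, pderiv_C]
    refine (hasFDerivAt_const c a).congr_fderiv ?_
    ext v
    simp
  | add p q hp hq =>
    simp only [map_add]
    refine (hp.add hq).congr_fderiv ?_
    ext v
    simp [add_mul, Finset.sum_add_distrib]
  | mul_X p i hp =>
    simp only [map_mul, eval_X]
    refine (hp.mul (hasFDerivAt_apply (𝕜 := ℂ) i a)).congr_fderiv ?_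
    ext v
    simp [Derivation.leibniz, pderiv_X, Pi.single_apply, Finset.sum_add_distrib, add_mul,
      apply_ite (eval a), Finset.mul_sum, mul_assoc]

/-- Division by f(a) brings the values near 1, where the principal logarithm is analytic; the
constant `c` restores the factor f(a). -/
theorem AnalyticAt.exists_pow_eq {E : Type*} [NormedAddCommGroup E] [NormedSpace ℂ E]
    {f : E → ℂ} {a : E} (hf : AnalyticAt ℂ f a) (h : f a ≠ 0) {n : ℕ} (hn : n ≠ 0) :
    ∃ k : E → ℂ, AnalyticAt ℂ k a ∧ k a ≠ 0 ∧ ∀ᶠ x in nhds a, k x ^ n = f x := by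
  obtain ⟨c, hc⟩ := IsAlgClosed.exists_pow_nat_eq (f a) (Nat.pos_of_ne_zero hn)
  have hd : AnalyticAt ℂ (fun x => f x / f a) a := hf.div analyticAt_const h
  have hlog : AnalyticAt ℂ (fun x => Complex.log (f x / f a)) a := hd.clog (by
    simp [div_self h])
  refine ⟨fun x => c * Complex.exp (Complex.log (f x / f a) / n),
    analyticAt_const.mul (hlog.div analyticAt_const (by simpa using hn)).cexp, ?_, ?_⟩
  · refine mul_ne_zero (fun h0 => h ?_) (Complex.exp_ne_zero _)
    rw [← hc, h0, zero_pow hn]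
  · filter_upwards [hf.continuousAt.eventually_ne h] with x hx
    rw [mul_pow, ← Complex.exp_nat_mul, mul_div_cancel₀ _ (by simpa using hn),
      Complex.exp_log (div_ne_zero hx h), hc, mul_div_cancel₀ _ h]

/-- The units are absorbed into the parameters by extracting a cube root of u₀ and square roots of
u₁, u₂. -/
theorem IsCuspForm.isTypeA {u L : Fin 3 → MvPolynomial (Fin 3) ℂ}
    {g : MvPolynomial (Fin 3) ℂ} {a : Fin 3 → ℂ} (h : IsCuspForm u L g a) :
    IsTypeA 2 g a := by
  have an : ∀ f : MvPolynomial (Fin 3) ℂ, AnalyticAt ℂ (fun x => eval x f) a := fun f =>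
    AnalyticOnNhd.eval_mvPolynomial f a (Set.mem_univ a)
  have hk : ∀ i, ∃ k : (Fin 3 → ℂ) → ℂ, AnalyticAt ℂ k a ∧ k a ≠ 0 ∧
      ∀ᶠ x in nhds a, k x ^ (![3, 2, 2] : Fin 3 → ℕ) i = eval x (u i) := fun i =>
    (an (u i)).exists_pow_eq (h.unit i) (by fin_cases i <;> simp)
  choose k hka hk0 hk using hk
  let Φ : (Fin 3 → ℂ) → (Fin 3 → ℂ) := fun x i => k i x * eval x (L i)
  let M : Matrix (Fin 3) (Fin 3) ℂ := Matrix.of fun i j => k i a * eval a (pderiv j (L i))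
  have hM : IsUnit M := by
    rw [Matrix.isUnit_iff_isUnit_det, isUnit_iff_ne_zero]
    have : M.det = (∏ i, k i a) * (Matrix.of fun i j => eval a (pderiv j (L i))).det := by
      rw [← Matrix.det_mul_column]; rfl
    rw [this]
    exact mul_ne_zero (Finset.prod_ne_zero_iff.2 fun i _ => hk0 i) h.det
  let e : (Fin 3 → ℂ) ≃L[ℂ] (Fin 3 → ℂ) :=
    (Matrix.toLinearEquiv' M hM.invertible).toContinuousLinearEquiv
  have he : ∀ v i, e v i = ∑ j, M i j * v j := fun v i => rfl
  refine ⟨Φ, e, analyticAt_pi_iff.2 fun i => (hka i).mul (an (L i)), ?_, ?_, ?_⟩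
  · funext i
    simp [Φ, h.zero]
  · rw [hasFDerivAt_pi']
    intro i
    refine ((hka i).differentiableAt.hasFDerivAt.mul
      (MvPolynomial.hasFDerivAt_eval (L i) a)).congr_fderiv ?_
    ext v
    simp [h.zero, he, M, Finset.mul_sum, mul_assoc]
  · filter_upwards [hk 0, hk 1, hk 2] with x h0 h1 h2
    simp at h0 h1 h2
    rw [h.eq]
    simp only [Φ, mul_pow, map_add, map_mul, map_pow]
    rw [← h0, ← h1, ← h2]

/-! ### Standard charts and independence of the representative -/

theorem chartIndex_mk {v : Fin 4 → ℂ} (hv : v ≠ 0) {i : Fin 4} (hi : v i ≠ 0)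
    (h : ∀ j, i < j → v j = 0) : chartIndex (Projectivization.mk ℂ v hv) = i := by
  obtain ⟨c, hc⟩ := Projectivization.exists_smul_eq_mk_rep ℂ v hv
  have hr : ∀ j, (Projectivization.mk ℂ v hv).rep j = c * v j := fun j => by
    rw [← hc]; rfl
  refine le_antisymm (Finset.max'_le _ _ _ fun j hj => ?_) (Finset.le_max' _ _ ?_)
  · by_contra hij
    rw [Finset.mem_filter, hr, h j (not_le.1 hij)] at hj
    simp at hj
  · rw [Finset.mem_filter, hr]
    exact ⟨Finset.mem_univ _, mul_ne_zero c.ne_zero hi⟩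

theorem affineCoord_mk {v : Fin 4 → ℂ} (hv : v ≠ 0) (i : Fin 4) :
    affineCoord (Projectivization.mk ℂ v hv) i = fun k => v (i.succAbove k) / v i := by
  obtain ⟨c, hc⟩ := Projectivization.exists_smul_eq_mk_rep ℂ v hv
  funext k
  rw [affineCoord, ← hc]
  exact mul_div_mul_left _ _ c.ne_zero

theorem eval_dehomogenize (F : MvPolynomial (Fin 4) ℂ) (i : Fin 4) (x : Fin 3 → ℂ) :
    eval x (dehomogenize F i) = eval (i.insertNth (1 : ℂ) x : Fin 4 → ℂ) F := by
  rw [dehomogenize, aeval_def, ← coe_eval₂Hom, ← RingHom.comp_apply]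
  revert F
  rw [← RingHom.ext_iff]
  refine MvPolynomial.ringHom_ext (fun c => by simp) fun j => ?_
  refine Fin.succAboveCases i ?_ (fun k => ?_) j <;> simp

theorem hasTypeA_and_milnorNumber_mk {F : MvPolynomial (Fin 4) ℂ} {v : Fin 4 → ℂ} (hv : v ≠ 0)
    {i : Fin 4} (hi : v i ≠ 0) (h : ∀ j, i < j → v j = 0) {u L : Fin 3 → MvPolynomial (Fin 3) ℂ}
    {a : Fin 3 → ℂ} (hF : IsCuspForm u L (dehomogenize F i) a)
    (ha : ∀ k, v (i.succAbove k) / v i = a k) :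
    HasTypeA 2 F (Projectivization.mk ℂ v hv) ∧
      milnorNumber F (Projectivization.mk ℂ v hv) = 2 := by
  rw [HasTypeA, milnorNumber, chartIndex_mk hv hi h, affineCoord_mk, funext ha]
  exact ⟨hF.isTypeA, hF.affineMilnorNumber_eq⟩

/-! ### Explicit equations of the singular points -/

/-- The equations of a singular point of `f_{s,t,0}` in coordinates. -/
def IsSingularVector (s t x y z w : ℂ) : Prop :=
  z / 16 * (x * (x ^ 4 - 10 * x ^ 2 * y ^ 2 + 5 * y ^ 4) - 5 * z * (x ^ 2 + y ^ 2) ^ 2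
      + 20 * z ^ 3 * (x ^ 2 + y ^ 2) - 16 * z ^ 5)
    = (s * (x ^ 2 + y ^ 2) + t * z ^ 2 + w ^ 2) ^ 3 ∧
  z * (5 * x ^ 4 - 30 * x ^ 2 * y ^ 2 + 5 * y ^ 4 - 20 * z * (x ^ 2 + y ^ 2) * x + 40 * z ^ 3 * x)
    = 96 * (s * (x ^ 2 + y ^ 2) + t * z ^ 2 + w ^ 2) ^ 2 * s * x ∧
  z * (-20 * x ^ 3 * y + 20 * x * y ^ 3 - 20 * z * (x ^ 2 + y ^ 2) * y + 40 * z ^ 3 * y)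
    = 96 * (s * (x ^ 2 + y ^ 2) + t * z ^ 2 + w ^ 2) ^ 2 * s * y ∧
  x * (x ^ 4 - 10 * x ^ 2 * y ^ 2 + 5 * y ^ 4) - 10 * z * (x ^ 2 + y ^ 2) ^ 2
      + 80 * z ^ 3 * (x ^ 2 + y ^ 2) - 96 * z ^ 5
    = 96 * (s * (x ^ 2 + y ^ 2) + t * z ^ 2 + w ^ 2) ^ 2 * t * z ∧
  (s * (x ^ 2 + y ^ 2) + t * z ^ 2 + w ^ 2) ^ 2 * w = 0

theorem eval_sexticForm (s t : ℂ) (v : Fin 4 → ℂ) :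
    eval v (sexticForm s t 0) = v 2 / 16 * (v 0 * (v 0 ^ 4 - 10 * v 0 ^ 2 * v 1 ^ 2 + 5 * v 1 ^ 4)
      - 5 * v 2 * (v 0 ^ 2 + v 1 ^ 2) ^ 2 + 20 * v 2 ^ 3 * (v 0 ^ 2 + v 1 ^ 2) - 16 * v 2 ^ 5)
      - (s * (v 0 ^ 2 + v 1 ^ 2) + t * v 2 ^ 2 + v 3 ^ 2) ^ 3 := by
  simp only [sexticForm, sexticForm₄, planesForm, quadricForm, map_sub, map_add, map_mul, map_pow,
    eval_C, eval_X]
  ring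

theorem isSingularVector_iff (s t : ℂ) (v : Fin 4 → ℂ) :
    IsSingularVector s t (v 0) (v 1) (v 2) (v 3) ↔
      eval v (sexticForm s t 0) = 0 ∧ ∀ i, eval v (pderiv i (sexticForm s t 0)) = 0 := by
  have h : ∀ i, eval v (pderiv i (sexticForm s t 0)) =
      1 / 16 * ![v 2 * (5 * v 0 ^ 4 - 30 * v 0 ^ 2 * v 1 ^ 2 + 5 * v 1 ^ 4
          - 20 * v 2 * (v 0 ^ 2 + v 1 ^ 2) * v 0 + 40 * v 2 ^ 3 * v 0)
        - 96 * (s * (v 0 ^ 2 + v 1 ^ 2) + t * v 2 ^ 2 + v 3 ^ 2) ^ 2 * s * v 0,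
        v 2 * (-20 * v 0 ^ 3 * v 1 + 20 * v 0 * v 1 ^ 3
          - 20 * v 2 * (v 0 ^ 2 + v 1 ^ 2) * v 1 + 40 * v 2 ^ 3 * v 1)
        - 96 * (s * (v 0 ^ 2 + v 1 ^ 2) + t * v 2 ^ 2 + v 3 ^ 2) ^ 2 * s * v 1,
        v 0 * (v 0 ^ 4 - 10 * v 0 ^ 2 * v 1 ^ 2 + 5 * v 1 ^ 4)
          - 10 * v 2 * (v 0 ^ 2 + v 1 ^ 2) ^ 2 + 80 * v 2 ^ 3 * (v 0 ^ 2 + v 1 ^ 2) - 96 * v 2 ^ 5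
        - 96 * (s * (v 0 ^ 2 + v 1 ^ 2) + t * v 2 ^ 2 + v 3 ^ 2) ^ 2 * t * v 2,
        -96 * ((s * (v 0 ^ 2 + v 1 ^ 2) + t * v 2 ^ 2 + v 3 ^ 2) ^ 2 * v 3)] i := by
    intro i
    fin_cases i <;> simp [sexticForm, sexticForm₄, planesForm, quadricForm, Derivation.leibniz,
      Derivation.leibniz_pow, pderiv_X] <;> ring
  simp only [h, eval_sexticForm, Fin.forall_fin_succ]
  simp [IsSingularVector, sub_eq_zero]

theorem isSingularVector_smul {c : ℂ} (hc : c ≠ 0) (s t x y z w : ℂ) :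
    IsSingularVector s t (c * x) (c * y) (c * z) (c * w) ↔ IsSingularVector s t x y z w := by
  have h5 : c ^ 5 ≠ 0 := pow_ne_zero _ hc
  have h6 : c ^ 6 ≠ 0 := pow_ne_zero _ hc
  unfold IsSingularVector
  refine and_congr ?_ (and_congr ?_ (and_congr ?_ (and_congr ?_ ?_)))
  · constructor <;> intro h
    · apply mul_left_cancel₀ h6; linear_combination h
    · linear_combination c ^ 6 * h
  · constructor <;> intro h
    · apply mul_left_cancel₀ h5; linear_combination h
    · linear_combination c ^ 5 * h
  · constructor <;> intro h
    · apply mul_left_cancel₀ h5; linear_combination h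
    · linear_combination c ^ 5 * h
  · constructor <;> intro h
    · apply mul_left_cancel₀ h5; linear_combination h
    · linear_combination c ^ 5 * h
  · constructor <;> intro h
    · apply mul_left_cancel₀ h5; linear_combination h
    · linear_combination c ^ 5 * h

theorem mk_mem_singularPoints_iff {s t : ℂ} {v : Fin 4 → ℂ} (hv : v ≠ 0) :
    Projectivization.mk ℂ v hv ∈ singularPoints (sexticForm s t 0) ↔
      IsSingularVector s t (v 0) (v 1) (v 2) (v 3) := by
  obtain ⟨c, hc⟩ := Projectivization.exists_smul_eq_mk_rep ℂ v hv
  rw [singularPoints, Set.mem_ofPred_eq, ← isSingularVector_iff, ← hc]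
  exact isSingularVector_smul c.ne_zero _ _ _ _ _ _

/-! ### Fivefold rotational symmetry and reduction to the axis -/

/-- The cosine of the rotation attached to a fifth root of unity `ζ`. -/
noncomputable def rotCos (ζ : ℂ) : ℂ := (ζ + ζ ^ 4) / 2

/-- The sine of the rotation attached to a fifth root of unity `ζ`. -/
noncomputable def rotSin (ζ : ℂ) : ℂ := -Complex.I * (ζ - ζ ^ 4) / 2

theorem rotCos_add_I_mul_rotSin (ζ : ℂ) : rotCos ζ + Complex.I * rotSin ζ = ζ := by
  unfold rotCos rotSin
  linear_combination (-(ζ - ζ ^ 4) / 2) * Complex.I_sq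

theorem rotCos_sub_I_mul_rotSin (ζ : ℂ) : rotCos ζ - Complex.I * rotSin ζ = ζ ^ 4 := by
  unfold rotCos rotSin
  linear_combination ((ζ - ζ ^ 4) / 2) * Complex.I_sq

theorem rotCos_sq_add_rotSin_sq {ζ : ℂ} (h : ζ ^ 5 = 1) : rotCos ζ ^ 2 + rotSin ζ ^ 2 = 1 := by
  unfold rotCos rotSin
  linear_combination h + ((ζ - ζ ^ 4) ^ 2 / 4) * Complex.I_sq

/-- This and `rot_im` expand (cos ± i sin)⁵ = 1; the bases are ζ and ζ⁴ = ζ⁻¹. -/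
theorem rot_re {ζ : ℂ} (h : ζ ^ 5 = 1) :
    rotCos ζ ^ 5 - 10 * rotCos ζ ^ 3 * rotSin ζ ^ 2 + 5 * rotCos ζ * rotSin ζ ^ 4 = 1 := by
  have h2 : rotSin ζ ^ 2 = -((ζ - ζ ^ 4) / 2) ^ 2 := by
    unfold rotSin
    linear_combination ((ζ - ζ ^ 4) ^ 2 / 4) * Complex.I_sq
  have h4 : rotSin ζ ^ 4 = ((ζ - ζ ^ 4) / 2) ^ 4 := by
    linear_combination (rotSin ζ ^ 2 - ((ζ - ζ ^ 4) / 2) ^ 2) * h2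
  rw [h2, h4, rotCos]
  linear_combination (1 + (ζ ^ 15 + ζ ^ 10 + ζ ^ 5 + 1)) / 2 * h

theorem rot_im {ζ : ℂ} (h : ζ ^ 5 = 1) :
    5 * rotCos ζ ^ 4 * rotSin ζ - 10 * rotCos ζ ^ 2 * rotSin ζ ^ 3 + rotSin ζ ^ 5 = 0 := by
  have h2 : rotSin ζ ^ 2 = -((ζ - ζ ^ 4) / 2) ^ 2 := by
    unfold rotSin
    linear_combination ((ζ - ζ ^ 4) ^ 2 / 4) * Complex.I_sq
  have h4 : rotSin ζ ^ 4 = ((ζ - ζ ^ 4) / 2) ^ 4 := by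
    linear_combination (rotSin ζ ^ 2 - ((ζ - ζ ^ 4) / 2) ^ 2) * h2
  have h5 : 5 * rotCos ζ ^ 4 * rotSin ζ - 10 * rotCos ζ ^ 2 * rotSin ζ ^ 3 + rotSin ζ ^ 5
      = rotSin ζ * (5 * rotCos ζ ^ 4 - 10 * rotCos ζ ^ 2 * rotSin ζ ^ 2 + rotSin ζ ^ 4) := by ring
  rw [h5, h2, h4, rotCos, rotSin]
  linear_combination Complex.I / 2 * (ζ ^ 15 + ζ ^ 10 + ζ ^ 5) * h

theorem rot_quintic {ζ : ℂ} (h : ζ ^ 5 = 1) (x y : ℂ) :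
    (rotCos ζ * x + rotSin ζ * y) * ((rotCos ζ * x + rotSin ζ * y) ^ 4
      - 10 * (rotCos ζ * x + rotSin ζ * y) ^ 2 * (-rotSin ζ * x + rotCos ζ * y) ^ 2
      + 5 * (-rotSin ζ * x + rotCos ζ * y) ^ 4)
    = x * (x ^ 4 - 10 * x ^ 2 * y ^ 2 + 5 * y ^ 4) := by
  linear_combination (x ^ 5 - 10 * x ^ 3 * y ^ 2 + 5 * x * y ^ 4) * rot_re h +
    (5 * x ^ 4 * y - 10 * x ^ 2 * y ^ 3 + y ^ 5) * rot_im h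

theorem rot_quadratic {ζ : ℂ} (h : ζ ^ 5 = 1) (x y : ℂ) :
    (rotCos ζ * x + rotSin ζ * y) ^ 2 + (-rotSin ζ * x + rotCos ζ * y) ^ 2 = x ^ 2 + y ^ 2 := by
  linear_combination (x ^ 2 + y ^ 2) * rotCos_sq_add_rotSin_sq h

/-- The gradient in x, y is k times (x, y). In a = x + iy and b = x - iy the two equations read 5a⁴
+ Kb = 0 and 5b⁴ + Ka = 0 with the same K, whence a⁵ = b⁵. This places (x, y) on one of the five
rotated axes. -/
theorem exists_rot_of_critical {x y k g : ℂ} (hxy : ¬(x = 0 ∧ y = 0))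
    (h0 : x * (x ^ 4 - 10 * x ^ 2 * y ^ 2 + 5 * y ^ 4) - 5 * (x ^ 2 + y ^ 2) ^ 2
      + 20 * (x ^ 2 + y ^ 2) - 16 = g)
    (hx : 5 * x ^ 4 - 30 * x ^ 2 * y ^ 2 + 5 * y ^ 4 - 20 * (x ^ 2 + y ^ 2) * x + 40 * x = k * x)
    (hy : -20 * x ^ 3 * y + 20 * x * y ^ 3 - 20 * (x ^ 2 + y ^ 2) * y + 40 * y = k * y) :
    ∃ ζ v : ℂ, ζ ^ 5 = 1 ∧ v ≠ 0 ∧ x = rotCos ζ * v ∧ y = rotSin ζ * v ∧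
      v ^ 5 - 5 * v ^ 4 + 20 * v ^ 2 - 16 = g ∧ 5 * v ^ 4 - 20 * v ^ 3 + 40 * v = k * v := by
  have hI := Complex.I_sq
  set a := x + Complex.I * y with ha
  set b := x - Complex.I * y with hb
  have hxa : x = (a + b) / 2 := by rw [ha, hb]; ring
  have hya : y = -Complex.I * (a - b) / 2 := by rw [ha, hb]; linear_combination y * hI
  have hI4 : Complex.I ^ 4 = 1 := by linear_combination (Complex.I ^ 2 - 1) * hI
  have hu : x ^ 2 + y ^ 2 = a * b := by rw [ha, hb]; linear_combination y ^ 2 * hI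
  have Ha : 5 * a ^ 4 + (-20 * (a * b) + 40 - k) * b = 0 := by
    rw [← hu, ha, hb]
    linear_combination hx - Complex.I * hy + (30 * x ^ 2 * y ^ 2 + 20 * Complex.I * x * y ^ 3) * hI
      + 5 * y ^ 4 * hI4
  have Hb : 5 * b ^ 4 + (-20 * (a * b) + 40 - k) * a = 0 := by
    rw [← hu, ha, hb]
    linear_combination hx + Complex.I * hy + (30 * x ^ 2 * y ^ 2 - 20 * Complex.I * x * y ^ 3) * hI
      + 5 * y ^ 4 * hI4
  have hab : a = 0 → b = 0 → False := fun h1 h2 => hxy ⟨by rw [hxa, h1, h2]; ring, by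
    rw [hya, h1, h2]; ring⟩
  have ha0 : a ≠ 0 := fun h => hab h (by
    rw [h] at Hb; exact eq_zero_of_pow_eq_zero (n := 4) (by linear_combination Hb / 5))
  have hb0 : b ≠ 0 := fun h => hab (by
    rw [h] at Ha; exact eq_zero_of_pow_eq_zero (n := 4) (by linear_combination Ha / 5)) h
  have h5 : a ^ 5 = b ^ 5 := by linear_combination a / 5 * Ha - b / 5 * Hb
  -- v = a³/b² and ζ = b²/a² solve ζv = a, ζ⁴v = b, which is the rotation in the coordinates a, b.
  have e1 : a ^ 3 / b ^ 2 * (b ^ 2 / a ^ 2) = a := by field_simp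
  have e2 : a ^ 3 / b ^ 2 * (b ^ 2 / a ^ 2) ^ 4 = b := by
    field_simp
    linear_combination -h5
  have hv2 : (a ^ 3 / b ^ 2) ^ 2 = a * b := by
    field_simp
    linear_combination h5
  have hv5 : (a ^ 3 / b ^ 2) ^ 5 = a ^ 5 := by
    field_simp
    linear_combination (a ^ 5 + b ^ 5) * h5
  have hv0 : a ^ 3 / b ^ 2 ≠ 0 := div_ne_zero (pow_ne_zero _ ha0) (pow_ne_zero _ hb0)
  refine ⟨b ^ 2 / a ^ 2, a ^ 3 / b ^ 2, ?_, hv0, ?_, ?_, ?_, ?_⟩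
  · field_simp
    linear_combination -(a ^ 5 + b ^ 5) * h5
  · rw [hxa, rotCos]
    linear_combination -(e1 + e2) / 2
  · rw [hya, rotSin]
    linear_combination Complex.I / 2 * (e1 - e2)
  · generalize a ^ 3 / b ^ 2 = v at *
    rw [hu] at h0
    have : x * (x ^ 4 - 10 * x ^ 2 * y ^ 2 + 5 * y ^ 4) = (a ^ 5 + b ^ 5) / 2 := by
      rw [ha, hb]
      linear_combination -(10 * x ^ 3 * y ^ 2) * hI - 5 * x * y ^ 4 * hI4
    rw [this] at h0
    linear_combination h0 + hv5 + (-5 * (v ^ 2 + a * b) + 20) * hv2 + h5 / 2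
  · generalize a ^ 3 / b ^ 2 = v at *
    apply mul_left_cancel₀ hv0
    linear_combination a * Ha + 5 * hv5 + (-20 * (v ^ 2 + a * b) + 40 - k) * hv2

/-- The quintic is (a⁵ + b⁵)/2, so here a⁵ = -b⁵; the extra factor -i turns the axis y = 0 into x =
0. -/
theorem exists_rot_of_quintic_eq_zero {x y : ℂ} (hxy : x ^ 2 + y ^ 2 ≠ 0)
    (h0 : x * (x ^ 4 - 10 * x ^ 2 * y ^ 2 + 5 * y ^ 4) = 0) :
    ∃ ζ l : ℂ, ζ ^ 5 = 1 ∧ l ≠ 0 ∧ x = -rotSin ζ * l ∧ y = rotCos ζ * l ∧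
      l ^ 2 = x ^ 2 + y ^ 2 := by
  have hI := Complex.I_sq
  set a := x + Complex.I * y with ha
  set b := x - Complex.I * y with hb
  have hxa : x = (a + b) / 2 := by rw [ha, hb]; ring
  have hya : y = -Complex.I * (a - b) / 2 := by rw [ha, hb]; linear_combination y * hI
  have hI4 : Complex.I ^ 4 = 1 := by linear_combination (Complex.I ^ 2 - 1) * hI
  have hu : x ^ 2 + y ^ 2 = a * b := by rw [ha, hb]; linear_combination y ^ 2 * hI
  have h5 : a ^ 5 = -b ^ 5 := by
    rw [ha, hb]
    linear_combination 2 * h0 + 20 * x ^ 3 * y ^ 2 * hI + 10 * x * y ^ 4 * hI4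
  rw [hu] at hxy ⊢
  have ha0 := left_ne_zero_of_mul hxy
  have hb0 := right_ne_zero_of_mul hxy
  have e1 : a ^ 3 / b ^ 2 * (b ^ 2 / a ^ 2) = a := by field_simp
  have e2 : a ^ 3 / b ^ 2 * (b ^ 2 / a ^ 2) ^ 4 = -b := by
    field_simp
    linear_combination h5
  have hv2 : (a ^ 3 / b ^ 2) ^ 2 = -(a * b) := by
    field_simp
    linear_combination h5
  refine ⟨b ^ 2 / a ^ 2, -Complex.I * (a ^ 3 / b ^ 2), ?_, ?_, ?_, ?_, ?_⟩
  · field_simp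
    linear_combination -(a ^ 5 - b ^ 5) * h5
  · exact mul_ne_zero (neg_ne_zero.2 Complex.I_ne_zero)
      (div_ne_zero (pow_ne_zero _ ha0) (pow_ne_zero _ hb0))
  · rw [hxa, rotSin]
    linear_combination -(e1 - e2) / 2 + (a ^ 3 / b ^ 2 * (b ^ 2 / a ^ 2) - a ^ 3 / b ^ 2 *
      (b ^ 2 / a ^ 2) ^ 4) / 2 * hI
  · rw [hya, rotCos]
    linear_combination Complex.I / 2 * (e1 + e2)
  · linear_combination (a ^ 3 / b ^ 2) ^ 2 * hI - hv2

/-- This and `rot_quartic_im` express (cos + i sin)⁴ = cos - i sin; they serve the x- and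
y-derivatives. -/
theorem rot_quartic_re {ζ : ℂ} (h : ζ ^ 5 = 1) :
    rotCos ζ ^ 4 - 6 * rotCos ζ ^ 2 * rotSin ζ ^ 2 + rotSin ζ ^ 4 = rotCos ζ := by
  have h2 : rotSin ζ ^ 2 = -((ζ - ζ ^ 4) / 2) ^ 2 := by
    unfold rotSin
    linear_combination ((ζ - ζ ^ 4) ^ 2 / 4) * Complex.I_sq
  have h4 : rotSin ζ ^ 4 = ((ζ - ζ ^ 4) / 2) ^ 4 := by
    linear_combination (rotSin ζ ^ 2 - ((ζ - ζ ^ 4) / 2) ^ 2) * h2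
  rw [h2, h4, rotCos]
  linear_combination (ζ ^ 11 + ζ ^ 6 + ζ) / 2 * h

theorem rot_quartic_im {ζ : ℂ} (h : ζ ^ 5 = 1) :
    4 * rotCos ζ ^ 3 * rotSin ζ - 4 * rotCos ζ * rotSin ζ ^ 3 = -rotSin ζ := by
  have h2 : rotSin ζ ^ 2 = -((ζ - ζ ^ 4) / 2) ^ 2 := by
    unfold rotSin
    linear_combination ((ζ - ζ ^ 4) ^ 2 / 4) * Complex.I_sq
  have h5 : 4 * rotCos ζ ^ 3 * rotSin ζ - 4 * rotCos ζ * rotSin ζ ^ 3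
      = 4 * rotCos ζ * rotSin ζ * (rotCos ζ ^ 2 - rotSin ζ ^ 2) := by ring
  rw [h5, h2, rotCos, rotSin]
  linear_combination Complex.I / 2 * (ζ ^ 11 + ζ ^ 6 + ζ) * h

/-! ### Representatives of the orbits and arithmetic modulo d² = -15 -/

/-- The image of the vector `e` under the rotation of the `x,y`-plane attached to `ζ`. -/
noncomputable def rotVector (ζ : ℂ) (e : Fin 4 → ℂ) : Fin 4 → ℂ :=
  ![rotCos ζ * e 0 - rotSin ζ * e 1, rotSin ζ * e 0 + rotCos ζ * e 1, e 2, e 3]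

/-- The seven representatives of the singular points modulo rotations; `d` is a square root
of `-15`. -/
def IsBaseVector (s d : ℂ) (e : Fin 4 → ℂ) : Prop :=
  (e 1 = 0 ∧ e 2 = 1 ∧ e 0 ^ 2 - 2 * e 0 - 4 = 0 ∧ e 3 ^ 2 = -s * (e 0 ^ 2 - (17 + d) / 2)) ∨
  (e 0 = (7 - d) / 2 ∧ e 1 = 0 ∧ e 2 = 1 ∧ e 3 = 0) ∨
  (e 0 = 0 ∧ e 1 = 1 ∧ e 2 = 0 ∧ e 3 ^ 2 = -s)

theorem exists_sqrt_of_isSpecialParameter {s t : ℂ} (hs : IsSpecialParameter s)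
    (ht : t = -4 * s * (2 ^ 7 * 3 ^ 2 / 5 * s ^ 3 + 1)) :
    ∃ d : ℂ, d ^ 2 = -15 ∧ s ^ 3 = 5 * (9 + d) / 9216 ∧ t = -s * (17 + d) / 2 ∧ s ≠ 0 := by
  unfold IsSpecialParameter at hs
  -- Completing the square: 96/25 times the sextic equation is d² + 15 = 0.
  refine ⟨9216 / 5 * s ^ 3 - 9, ?_, by ring, by rw [ht]; ring, ?_⟩
  · linear_combination 96 / 25 * hs
  · rintro rfl
    norm_num at hs

/-- The product with the conjugate a - bd is the norm a² + 15b². -/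
theorem add_mul_ne_zero_of_sq_eq {d : ℂ} (hd : d ^ 2 = -15)
    (a b : ℝ) (hab : a ^ 2 + 15 * b ^ 2 ≠ 0) :
    (a : ℂ) + b * d ≠ 0 := by
  intro h
  have h2 : ((a ^ 2 + 15 * b ^ 2 : ℝ) : ℂ) = 0 := by
    push_cast
    linear_combination (a - b * d) * h + (b : ℂ) ^ 2 * hd
  exact hab (by exact_mod_cast h2)

/-- This keeps the double points over v away from w = 0, so that ±w are distinct. -/
theorem sq_sub_ne_zero_of_quadratic {d v : ℂ} (hd : d ^ 2 = -15) (hv : v ^ 2 - 2 * v - 4 = 0) :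
    v ^ 2 - (17 + d) / 2 ≠ 0 := by
  intro h
  have h1 : v = (9 + d) / 4 := by linear_combination (h - hv) / 2
  rw [h1] at hv
  apply add_mul_ne_zero_of_sq_eq hd (-7) 1 (by norm_num)
  push_cast
  linear_combination 8 / 5 * hv - hd / 10

/-- The cofactor of the triple root `(7 - d) / 2` of the equation of the curve `w = 0` on the
axis `y = 0`. -/
noncomputable def axisCofactor (d v : ℂ) : ℂ :=
  ((441 - 31 * d) + (333 + 21 * d) * v + (-9 + 15 * d) * v ^ 2 + (-45 - 5 * d) * v ^ 3) / 9216

theorem axis_factorization {d : ℂ} (hd : d ^ 2 = -15) (v : ℂ) :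
    v ^ 5 - 5 * v ^ 4 + 20 * v ^ 2 - 16 - 16 * (5 * (9 + d) / 9216) * (v ^ 2 - (17 + d) / 2) ^ 3
      = 16 * (v - (7 - d) / 2) ^ 3 * axisCofactor d v := by
  unfold axisCofactor
  linear_combination ((553/128) + (-11/64) * d + (1/128) * d ^ 2 + (-343/1536) * v + (49/768) * v *
    d + (-7/1536) * v * d ^ 2 + (-369/512) * v ^ 2 + (7/192) * v ^ 2 * d + (-5/1536) * v ^ 2 * d ^ 2
    + (259/1536) * v ^ 3 + (-25/768) * v ^ 3 * d + (5/4608) * v ^ 3 * d ^ 2 + (-15/256) * v ^ 4 +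
    (5/768) * v ^ 4 * d + (5/384) * v ^ 5) * hd

theorem axis_factorization_deriv {d : ℂ} (hd : d ^ 2 = -15) (v : ℂ) :
    5 * v ^ 4 - 20 * v ^ 3 + 40 * v - 96 * (5 * (9 + d) / 9216) * (v ^ 2 - (17 + d) / 2) ^ 2 * v
      = 16 * (3 * (v - (7 - d) / 2) ^ 2 * axisCofactor d v + (v - (7 - d) / 2) ^ 3 *
        (((333 + 21 * d) + 2 * (-9 + 15 * d) * v + 3 * (-45 - 5 * d) * v ^ 2) / 9216)) := by
  unfold axisCofactor
  linear_combination ((-343/1536) + (49/768) * d + (-7/1536) * d ^ 2 + (-369/256) * v + (7/96) * v *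
    d + (-5/768) * v * d ^ 2 + (259/512) * v ^ 2 + (-25/256) * v ^ 2 * d + (5/1536) * v ^ 2 * d ^ 2
    + (-15/64) * v ^ 3 + (5/192) * v ^ 3 * d + (25/384) * v ^ 4) * hd

/-- The root is exactly triple, which makes the singularity A₂ and not worse. -/
theorem axisCofactor_ne_zero {d : ℂ} (hd : d ^ 2 = -15) :
    axisCofactor d ((7 - d) / 2) ≠ 0 := by
  have h : axisCofactor d ((7 - d) / 2) = ((15 / 128 : ℝ) : ℂ) + ((95 / 1152 : ℝ) : ℂ) * d := by
    unfold axisCofactor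
    push_cast
    linear_combination ((-269/24576) + (-5/12288) * d + (5/73728) * d ^ 2) * hd
  rw [h]
  exact add_mul_ne_zero_of_sq_eq hd _ _ (by norm_num)

/-- The left side is the coefficient of y² in p - q³ at the extra point on the axis. -/
theorem axis_transversal_ne_zero {d : ℂ} (hd : d ^ 2 = -15) :
    (-10 * ((7 - d) / 2) ^ 3 - 10 * ((7 - d) / 2) ^ 2 + 20) / 16
      - 3 * (5 * (9 + d) / 9216) * (((7 - d) / 2) ^ 2 - (17 + d) / 2) ^ 2 ≠ 0 := by
  have h : (-10 * ((7 - d) / 2) ^ 3 - 10 * ((7 - d) / 2) ^ 2 + 20) / 16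
      - 3 * (5 * (9 + d) / 9216) * (((7 - d) / 2) ^ 2 - (17 + d) / 2) ^ 2 =
      ((-175 / 64 : ℝ) : ℂ) + ((825 / 64 : ℝ) : ℂ) * d := by
    push_cast
    linear_combination ((-33505/16384) + (3925/49152) * d + (115/49152) * d ^ 2 + (-5/49152) * d ^
      3) * hd
  rw [h]
  exact add_mul_ne_zero_of_sq_eq hd _ _ (by norm_num)

/-- Any other double root would be a double root of the cubic cofactor, which is coprime to its
derivative. -/
theorem eq_of_double_root {d v : ℂ} (hd : d ^ 2 = -15)
    (h0 : v ^ 5 - 5 * v ^ 4 + 20 * v ^ 2 - 16 = 16 * (5 * (9 + d) / 9216) *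
      (v ^ 2 - (17 + d) / 2) ^ 3)
    (h1 : 5 * v ^ 4 - 20 * v ^ 3 + 40 * v =
      96 * (5 * (9 + d) / 9216) * (v ^ 2 - (17 + d) / 2) ^ 2 * v) :
    v = (7 - d) / 2 := by
  by_contra hv
  have h := axis_factorization hd v
  have h' := axis_factorization_deriv hd v
  rw [sub_eq_zero.2 h0, eq_comm] at h
  rw [sub_eq_zero.2 h1, eq_comm] at h'
  have hv3 : (v - (7 - d) / 2) ^ 3 ≠ 0 := pow_ne_zero _ (sub_ne_zero.2 hv)
  have hE : axisCofactor d v = 0 :=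
    (mul_eq_zero.1 h).resolve_left (mul_ne_zero (by norm_num) hv3)
  rw [hE, mul_zero, zero_add] at h'
  have hE' : ((333 + 21 * d) + 2 * (-9 + 15 * d) * v + 3 * (-45 - 5 * d) * v ^ 2) / 9216 = 0 :=
    (mul_eq_zero.1 ((mul_eq_zero.1 h').resolve_left (by norm_num))).resolve_left hv3
  unfold axisCofactor at hE
  -- The multipliers of `hE` and `hE'` are Bézout coefficients of the cofactor and its derivative.
  exact one_ne_zero (α := ℂ) (by
    linear_combination (5934 + 802 * d + (-2745 - 415 * d) * v) / 170 * hE +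
      (-13464 - 680 * d + (-5586 - 1118 * d) * v + (2745 + 415 * d) * v ^ 2) / 510 * hE'
      - ((-4937/261120) + (5027/522240) * v + (-13/13056) * v ^ 2 + (-11/34816) * v ^ 3) * hd)

/-! ### Classification of the singular points -/

theorem IsSingularVector.exists_rotVector {s t d : ℂ} (hd : d ^ 2 = -15)
    (hs3 : s ^ 3 = 5 * (9 + d) / 9216) (ht : t = -s * (17 + d) / 2)
    {p : Fin 4 → ℂ} (hp : p ≠ 0) (h : IsSingularVector s t (p 0) (p 1) (p 2) (p 3)) :
    ∃ ζ e, ζ ^ 5 = 1 ∧ IsBaseVector s d e ∧ ∃ c : ℂ, c ≠ 0 ∧ p = c • rotVector ζ e := by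
  by_cases hz : p 2 = 0
  · obtain ⟨h0, h1, h2, h3, h4⟩ := h
    rw [hz] at h0 h1 h2 h3 h4
    have hQ : s * (p 0 ^ 2 + p 1 ^ 2) + t * 0 ^ 2 + p 3 ^ 2 = 0 :=
      eq_zero_of_pow_eq_zero (n := 3) (by rw [← h0]; ring)
    rw [hQ] at h3
    have h5 : p 0 * (p 0 ^ 4 - 10 * p 0 ^ 2 * p 1 ^ 2 + 5 * p 1 ^ 4) = 0 := by
      linear_combination h3
    have hxy : p 0 ^ 2 + p 1 ^ 2 ≠ 0 := by
      intro hu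
      apply hp
      have hw : p 3 = 0 := eq_zero_of_pow_eq_zero (n := 2) (by linear_combination hQ - s * hu)
      have h6 : 16 * p 0 ^ 5 = 0 := by
        linear_combination h5 + (15 * p 0 ^ 3 - 5 * p 0 * p 1 ^ 2) * hu
      have hx : p 0 = 0 := eq_zero_of_pow_eq_zero (n := 5) (by linear_combination h6 / 16)
      have hy : p 1 = 0 := eq_zero_of_pow_eq_zero (n := 2) (by linear_combination hu - p 0 * hx)
      funext i
      fin_cases i <;> assumption
    obtain ⟨ζ, l, hζ, hl, hx, hy, hl2⟩ := exists_rot_of_quintic_eq_zero hxy h5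
    refine ⟨ζ, ![0, 1, 0, p 3 / l], hζ, Or.inr (Or.inr ⟨rfl, rfl, rfl, ?_⟩), l, hl, ?_⟩
    · simp only [Matrix.cons_val]
      field_simp
      linear_combination hQ + s * hl2
    · funext i
      fin_cases i <;> simp [rotVector, hz, mul_div_cancel₀ _ hl]
      · rw [hx]; ring
      · rw [hy]; ring
  · set x := p 0 / p 2 with hx
    set y := p 1 / p 2 with hy
    set w := p 3 / p 2 with hw
    have ex : p 0 = p 2 * x := by rw [hx]; field_simp
    have ey : p 1 = p 2 * y := by rw [hy]; field_simp
    have ew : p 3 = p 2 * w := by rw [hw]; field_simp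
    suffices H : ∃ ζ e, ζ ^ 5 = 1 ∧ IsBaseVector s d e ∧ ![x, y, 1, w] = rotVector ζ e by
      obtain ⟨ζ, e, hζ, he, H⟩ := H
      refine ⟨ζ, e, hζ, he, p 2, hz, ?_⟩
      rw [← H]
      funext i
      fin_cases i <;> simp [← ex, ← ey, ← ew]
    have hsing : IsSingularVector s t x y 1 w := by
      rw [← isSingularVector_smul hz, mul_one, ← ex, ← ey, ← ew]
      exact h
    clear_value x y w
    clear h hx hy hw ex ey ew hp
    obtain ⟨h0, h1, h2, h3, h4⟩ := hsing
    have hvec : ∀ ζ v : ℂ, x = rotCos ζ * v → y = rotSin ζ * v →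
        ![x, y, 1, w] = rotVector ζ ![v, 0, 1, w] := fun ζ v hx hy => by
      simp [rotVector, hx, hy]
    by_cases hQ : s * (x ^ 2 + y ^ 2) + t * 1 ^ 2 + w ^ 2 = 0
    · rw [hQ] at h0 h1 h2 h3
      obtain ⟨ζ, v, hζ, hv0, hx, hy, e0, e1⟩ :=
        exists_rot_of_critical (x := x) (y := y) (k := 0) (g := 0) (by
          rintro ⟨rfl, rfl⟩
          norm_num at h0) (by linear_combination 16 * h0) (by linear_combination h1)
          (by linear_combination h2)
      refine ⟨ζ, ![v, 0, 1, w], hζ, Or.inl ⟨rfl, rfl, ?_, ?_⟩, hvec ζ v hx hy⟩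
      · simp only [Matrix.cons_val]
        -- On the axis the five planes give a simple root 1, excluded by the derivative, and two
        -- double roots.
        have e2 : (v - 1) * (v ^ 2 - 2 * v - 4) ^ 2 = 0 := by linear_combination e0
        rcases mul_eq_zero.1 e2 with e3 | e3
        · rw [sub_eq_zero.1 e3] at e1
          norm_num at e1
        · exact eq_zero_of_pow_eq_zero e3
      · simp only [Matrix.cons_val]
        rw [ht, hx, hy] at hQ
        linear_combination hQ - s * v ^ 2 * rotCos_sq_add_rotSin_sq hζ
    · have hw : w = 0 := (mul_eq_zero.1 h4).resolve_left (pow_ne_zero 2 hQ)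
      subst hw
      obtain ⟨ζ, v, hζ, hv0, hx, hy, e0, e1⟩ :=
        exists_rot_of_critical (x := x) (y := y)
          (k := 96 * (s * (x ^ 2 + y ^ 2) + t * 1 ^ 2 + 0 ^ 2) ^ 2 * s)
          (g := 16 * (s * (x ^ 2 + y ^ 2) + t * 1 ^ 2 + 0 ^ 2) ^ 3) (by
          rintro ⟨rfl, rfl⟩
          rw [ht] at h0
          -- At x = y = 0 the equation says t³ = -1, which reduces to the vanishing of this element.
          apply add_mul_ne_zero_of_sq_eq hd (681 / 1024) (7385 / 9216) (by norm_num)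
          push_cast
          linear_combination h0 - ((17 + d) / 2) ^ 3 * hs3 - ((2185/24576) + (25/6144) * d +
            (5/73728) * d ^ 2) * hd)
          (by linear_combination 16 * h0) (by linear_combination h1)
          (by linear_combination h2)
      have hu : x ^ 2 + y ^ 2 = v ^ 2 := by
        rw [hx, hy]
        linear_combination v ^ 2 * rotCos_sq_add_rotSin_sq hζ
      have hv : v = (7 - d) / 2 := by
        rw [hu, ht] at e0 e1
        apply eq_of_double_root hd
        · linear_combination e0 + 16 * (v ^ 2 - (17 + d) / 2) ^ 3 * hs3
        · linear_combination e1 + 96 * (v ^ 2 - (17 + d) / 2) ^ 2 * v * hs3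
      refine ⟨ζ, ![v, 0, 1, 0], hζ, Or.inr (Or.inl ⟨hv, rfl, rfl, rfl⟩), hvec ζ v hx hy⟩

theorem IsBaseVector.rotVector_ne_zero {s d ζ : ℂ} {e : Fin 4 → ℂ} (he : IsBaseVector s d e)
    (hζ : ζ ^ 5 = 1) : rotVector ζ e ≠ 0 := by
  intro h
  have h0 : rotCos ζ * e 0 - rotSin ζ * e 1 = 0 := congrFun h 0
  have h1 : rotSin ζ * e 0 + rotCos ζ * e 1 = 0 := congrFun h 1
  have h2 : e 2 = 0 := congrFun h 2
  have hr := rotCos_sq_add_rotSin_sq hζ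
  rcases he with ⟨-, hz, -⟩ | ⟨-, -, hz, -⟩ | ⟨hx, hy, -⟩
  · exact one_ne_zero (hz.symm.trans h2)
  · exact one_ne_zero (hz.symm.trans h2)
  · rw [hx, hy] at h0 h1
    exact one_ne_zero (α := ℂ) (by linear_combination -hr + rotCos ζ * h1 - rotSin ζ * h0)

theorem IsBaseVector.isSingularVector {s t d ζ : ℂ} {e : Fin 4 → ℂ} (he : IsBaseVector s d e)
    (hd : d ^ 2 = -15) (hs3 : s ^ 3 = 5 * (9 + d) / 9216) (ht : t = -s * (17 + d) / 2)
    (hζ : ζ ^ 5 = 1) :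
    IsSingularVector s t (rotVector ζ e 0) (rotVector ζ e 1) (rotVector ζ e 2)
      (rotVector ζ e 3) := by
  have hr := rotCos_sq_add_rotSin_sq hζ
  have h5 := rot_re hζ
  have h4r := rot_quartic_re hζ
  have h4i := rot_quartic_im hζ
  simp only [rotVector, Matrix.cons_val]
  rcases he with ⟨hy, hz, hq, hw⟩ | ⟨hx, hy, hz, hw⟩ | ⟨hx, hy, hz, hw⟩
  · rw [hy, hz]
    generalize e 0 = v at *
    generalize e 3 = w at *
    generalize rotCos ζ = α at *
    generalize rotSin ζ = β at *
    have hQ : s * ((α * v - β * 0) ^ 2 + (β * v + α * 0) ^ 2) + t * 1 ^ 2 + w ^ 2 = 0 := by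
      rw [ht]
      linear_combination hw + s * v ^ 2 * hr
    unfold IsSingularVector
    rw [hQ]
    refine ⟨?_, ?_, ?_, ?_, by ring⟩
    · linear_combination v ^ 5 / 16 * h5 + (-5 * v ^ 4 * (α ^ 2 + β ^ 2 + 1) + 20 * v ^ 2) / 16 * hr
        + (v - 1) * (v ^ 2 - 2 * v - 4) / 16 * hq
    · linear_combination 5 * v ^ 4 * h4r - 20 * v ^ 3 * α * hr + 5 * α * v * (v - 2) * hq
    · linear_combination -5 * v ^ 4 * h4i - 20 * v ^ 3 * β * hr + 5 * β * v * (v - 2) * hq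
    · linear_combination v ^ 5 * h5 + (-10 * v ^ 4 * (α ^ 2 + β ^ 2 + 1) + 80 * v ^ 2) * hr
        + (v ^ 3 - 8 * v ^ 2 - 12 * v + 24) * hq
  · have h0 := axis_factorization hd (e 0)
    have h1 := axis_factorization_deriv hd (e 0)
    rw [hx, sub_self] at h0 h1
    rw [hx, hy, hz, hw]
    generalize (7 - d) / 2 = v at *
    generalize rotCos ζ = α at *
    generalize rotSin ζ = β at *
    have hQ : s * ((α * v - β * 0) ^ 2 + (β * v + α * 0) ^ 2) + t * 1 ^ 2 + 0 ^ 2 =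
        s * (v ^ 2 - (17 + d) / 2) := by
      rw [ht]
      linear_combination s * v ^ 2 * hr
    unfold IsSingularVector
    rw [hQ]
    have E0 : 1 / 16 * ((α * v - β * 0) * ((α * v - β * 0) ^ 4
        - 10 * (α * v - β * 0) ^ 2 * (β * v + α * 0) ^ 2 + 5 * (β * v + α * 0) ^ 4)
        - 5 * 1 * ((α * v - β * 0) ^ 2 + (β * v + α * 0) ^ 2) ^ 2
        + 20 * 1 ^ 3 * ((α * v - β * 0) ^ 2 + (β * v + α * 0) ^ 2) - 16 * 1 ^ 5) =
        (s * (v ^ 2 - (17 + d) / 2)) ^ 3 := by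
      linear_combination v ^ 5 / 16 * h5
        + (-5 * v ^ 4 * (α ^ 2 + β ^ 2 + 1) + 20 * v ^ 2) / 16 * hr
        + h0 / 16 - (v ^ 2 - (17 + d) / 2) ^ 3 * hs3
    have Ex : 1 * (5 * (α * v - β * 0) ^ 4 - 30 * (α * v - β * 0) ^ 2 * (β * v + α * 0) ^ 2
        + 5 * (β * v + α * 0) ^ 4
        - 20 * 1 * ((α * v - β * 0) ^ 2 + (β * v + α * 0) ^ 2) * (α * v - β * 0)
        + 40 * 1 ^ 3 * (α * v - β * 0)) =
        96 * (s * (v ^ 2 - (17 + d) / 2)) ^ 2 * s * (α * v - β * 0) := by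
      linear_combination 5 * v ^ 4 * h4r - 20 * v ^ 3 * α * hr + α * h1
        - 96 * (v ^ 2 - (17 + d) / 2) ^ 2 * v * α * hs3
    have Ey : 1 * (-20 * (α * v - β * 0) ^ 3 * (β * v + α * 0)
        + 20 * (α * v - β * 0) * (β * v + α * 0) ^ 3
        - 20 * 1 * ((α * v - β * 0) ^ 2 + (β * v + α * 0) ^ 2) * (β * v + α * 0)
        + 40 * 1 ^ 3 * (β * v + α * 0)) =
        96 * (s * (v ^ 2 - (17 + d) / 2)) ^ 2 * s * (β * v + α * 0) := by
      linear_combination -5 * v ^ 4 * h4i - 20 * v ^ 3 * β * hr + β * h1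
        - 96 * (v ^ 2 - (17 + d) / 2) ^ 2 * v * β * hs3
    refine ⟨E0, Ex, Ey, ?_, by ring⟩
    rw [ht]
    -- Euler's relation in degree 6 gives the z-derivative from the other equations, since z = 1 and
    -- w = 0.
    linear_combination 96 * E0 - (α * v - β * 0) * Ex - (β * v + α * 0) * Ey
      - 96 * (s * (v ^ 2 - (17 + d) / 2)) ^ 2 * s * v ^ 2 * hr
  · have hi := rot_im hζ
    rw [hx, hy, hz]
    generalize e 3 = w at *
    generalize rotCos ζ = α at *
    generalize rotSin ζ = β at *
    have hQ : s * ((α * 0 - β * 1) ^ 2 + (β * 0 + α * 1) ^ 2) + t * 0 ^ 2 + w ^ 2 = 0 := by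
      linear_combination hw + s * hr
    unfold IsSingularVector
    rw [hQ]
    refine ⟨by ring, by ring, by ring, ?_, by ring⟩
    linear_combination -hi

/-! ### Cusp certificates at the three kinds of points -/

/-- The first rotated coordinate as a polynomial. -/
noncomputable def rotX (ζ : ℂ) : MvPolynomial (Fin 3) ℂ :=
  C (rotCos ζ) * X 0 + C (rotSin ζ) * X 1

/-- The second rotated coordinate as a polynomial. -/
noncomputable def rotY (ζ : ℂ) : MvPolynomial (Fin 3) ℂ :=
  C (-rotSin ζ) * X 0 + C (rotCos ζ) * X 1

theorem eval_rotX (ζ : ℂ) (x : Fin 3 → ℂ) :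
    eval x (rotX ζ) = rotCos ζ * x 0 + rotSin ζ * x 1 := by
  simp [rotX]

theorem eval_rotY (ζ : ℂ) (x : Fin 3 → ℂ) :
    eval x (rotY ζ) = -rotSin ζ * x 0 + rotCos ζ * x 1 := by
  simp [rotY]

theorem pderiv_rotX (ζ : ℂ) (i : Fin 3) :
    pderiv i (rotX ζ) = C (![rotCos ζ, rotSin ζ, 0] i) := by
  fin_cases i <;> simp [rotX, pderiv_X, Derivation.leibniz]

theorem pderiv_rotY (ζ : ℂ) (i : Fin 3) :
    pderiv i (rotY ζ) = C (![-rotSin ζ, rotCos ζ, 0] i) := by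
  fin_cases i <;> simp [rotY, pderiv_X, Derivation.leibniz]

theorem eval_dehomogenize_three (s t : ℂ) (x : Fin 3 → ℂ) :
    eval x (dehomogenize (sexticForm s t 0) 3) =
      x 2 / 16 * (x 0 * (x 0 ^ 4 - 10 * x 0 ^ 2 * x 1 ^ 2 + 5 * x 1 ^ 4)
        - 5 * x 2 * (x 0 ^ 2 + x 1 ^ 2) ^ 2 + 20 * x 2 ^ 3 * (x 0 ^ 2 + x 1 ^ 2) - 16 * x 2 ^ 5)
      - (s * (x 0 ^ 2 + x 1 ^ 2) + t * x 2 ^ 2 + 1) ^ 3 := by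
  rw [eval_dehomogenize, eval_sexticForm]
  change x 2 / 16 * (x 0 * (x 0 ^ 4 - 10 * x 0 ^ 2 * x 1 ^ 2 + 5 * x 1 ^ 4)
        - 5 * x 2 * (x 0 ^ 2 + x 1 ^ 2) ^ 2 + 20 * x 2 ^ 3 * (x 0 ^ 2 + x 1 ^ 2) - 16 * x 2 ^ 5)
      - (s * (x 0 ^ 2 + x 1 ^ 2) + t * x 2 ^ 2 + 1 ^ 2) ^ 3 = _
  rw [one_pow]

theorem eval_dehomogenize_two (s t : ℂ) (x : Fin 3 → ℂ) :
    eval x (dehomogenize (sexticForm s t 0) 2) =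
      1 / 16 * (x 0 * (x 0 ^ 4 - 10 * x 0 ^ 2 * x 1 ^ 2 + 5 * x 1 ^ 4)
        - 5 * (x 0 ^ 2 + x 1 ^ 2) ^ 2 + 20 * (x 0 ^ 2 + x 1 ^ 2) - 16)
      - (s * (x 0 ^ 2 + x 1 ^ 2) + t + x 2 ^ 2) ^ 3 := by
  rw [eval_dehomogenize, eval_sexticForm]
  change 1 / 16 * (x 0 * (x 0 ^ 4 - 10 * x 0 ^ 2 * x 1 ^ 2 + 5 * x 1 ^ 4)
        - 5 * 1 * (x 0 ^ 2 + x 1 ^ 2) ^ 2 + 20 * 1 ^ 3 * (x 0 ^ 2 + x 1 ^ 2) - 16 * 1 ^ 5)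
      - (s * (x 0 ^ 2 + x 1 ^ 2) + t * 1 ^ 2 + x 2 ^ 2) ^ 3 = _
  ring

/-- The quadric in the chart `w = 1`. -/
noncomputable def affineQuadric (s t : ℂ) : MvPolynomial (Fin 3) ℂ :=
  C s * (X 0 ^ 2 + X 1 ^ 2) + C t * X 2 ^ 2 + 1

/-- With a, b the rotated coordinates, p at b = 0 is z(a - z)(a - vz)²(a - (2 - v)z)²/16, because v
and 2 - v are the two roots of the quadratic. The rest of p is divisible by b², and the cube is that
of the quadric. Here m is 1/w. -/
theorem isCuspForm_of_double_point {s t v m ζ : ℂ} (hζ : ζ ^ 5 = 1)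
    (hv : v ^ 2 - 2 * v - 4 = 0) (hm : (s * v ^ 2 + t) * m ^ 2 = -1) :
    IsCuspForm
      ![-1, C (1 / 16) * X 2 * (rotX ζ - X 2) * (rotX ζ - C (2 - v) * X 2) ^ 2,
        C (1 / 16) * X 2 * (-10 * rotX ζ ^ 3 + 5 * rotX ζ * rotY ζ ^ 2
          - 5 * X 2 * (2 * rotX ζ ^ 2 + rotY ζ ^ 2) + 20 * X 2 ^ 3)]
      ![affineQuadric s t, rotX ζ - C v * X 2, rotY ζ]
      (dehomogenize (sexticForm s t 0) 3) ![rotCos ζ * v * m, rotSin ζ * v * m, m] := by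
  have hr := rotCos_sq_add_rotSin_sq hζ
  have hm0 : m ≠ 0 := by rintro rfl; simp at hm
  have eX : eval ![rotCos ζ * v * m, rotSin ζ * v * m, m] (rotX ζ) = v * m := by
    rw [eval_rotX]
    simp only [Matrix.cons_val]
    linear_combination v * m * hr
  have eY : eval ![rotCos ζ * v * m, rotSin ζ * v * m, m] (rotY ζ) = 0 := by
    rw [eval_rotY]
    simp only [Matrix.cons_val]
    ring
  refine ⟨?_, ?_, ?_, ?_⟩
  · refine MvPolynomial.funext fun x => ?_
    rw [eval_dehomogenize_three]
    simp only [Matrix.cons_val, affineQuadric, map_add, map_sub, map_mul, map_pow, map_neg, map_one,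
      map_ofNat, eval_C, eval_X, eval_rotX, eval_rotY]
    rw [← rot_quintic hζ, ← rot_quadratic hζ]
    generalize rotCos ζ * x 0 + rotSin ζ * x 1 = a
    generalize -rotSin ζ * x 0 + rotCos ζ * x 1 = b
    linear_combination x 2 ^ 3 / 16 * (a - x 2) * (a ^ 2 - 2 * a * x 2 - 4 * x 2 ^ 2
      + (a - v * x 2) * (a - (2 - v) * x 2)) * hv
  · intro i
    fin_cases i
    · simp
    · simp only [Fin.mk_one, Matrix.cons_val, map_mul, map_sub, map_pow, eval_C, eval_X, eX]
      have : 1 / 16 * m * (v * m - m) * (v * m - (2 - v) * m) ^ 2 = m ^ 4 * (v - 1) * 5 / 4 := by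
        linear_combination m ^ 4 * (v - 1) / 4 * hv
      rw [this]
      have : v - 1 ≠ 0 := fun h => by
        rw [sub_eq_zero.1 h] at hv
        norm_num at hv
      simp [hm0, this]
    · simp only [Fin.reduceFinMk, Matrix.cons_val, map_add, map_mul, map_sub, map_pow, map_neg,
        map_ofNat, eval_C, eval_X, eX, eY]
      have : 1 / 16 * m * (-10 * (v * m) ^ 3 + 5 * (v * m) * 0 ^ 2
          - 5 * m * (2 * (v * m) ^ 2 + 0 ^ 2) + 20 * m ^ 3) = -(25 / 4) * m ^ 4 * (v + 1) := by
        linear_combination -(5 / 8) * m ^ 4 * (v + 3) * hv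
      rw [this]
      have : v + 1 ≠ 0 := fun h => by
        rw [eq_neg_of_add_eq_zero_left h] at hv
        norm_num at hv
      simp [hm0, this]
  · intro i
    fin_cases i
    · simp [affineQuadric]
      linear_combination hm + s * v ^ 2 * m ^ 2 * hr
    · simp [eX]
    · simpa using eY
  · have : ∀ D : ℂ, D * m = -2 → D ≠ 0 := fun D hD h => by
      rw [h] at hD
      norm_num at hD
    apply this
    simp [Matrix.det_fin_three, affineQuadric, pderiv_rotX, pderiv_rotY, Derivation.leibniz,
      Derivation.leibniz_pow, pderiv_X]
    linear_combination 2 * hm + (2 * s * v ^ 2 * m ^ 2 + 2 * t * m ^ 2) * hr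

/-- Here p = zR with z and R local parameters, and zR = ((z + R)² - (z - R)²)/4. -/
theorem isCuspForm_of_infinite_double_point {s t m ζ : ℂ} (hζ : ζ ^ 5 = 1) (hm : s * m ^ 2 = -1) :
    IsCuspForm ![-1, C (1 / 4), C (-1 / 4)]
      ![affineQuadric s t,
        X 2 + C (1 / 16) * (rotX ζ * (rotX ζ ^ 4 - 10 * rotX ζ ^ 2 * rotY ζ ^ 2 + 5 * rotY ζ ^ 4)
          - 5 * X 2 * (rotX ζ ^ 2 + rotY ζ ^ 2) ^ 2 + 20 * X 2 ^ 3 * (rotX ζ ^ 2 + rotY ζ ^ 2)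
          - 16 * X 2 ^ 5),
        X 2 - C (1 / 16) * (rotX ζ * (rotX ζ ^ 4 - 10 * rotX ζ ^ 2 * rotY ζ ^ 2 + 5 * rotY ζ ^ 4)
          - 5 * X 2 * (rotX ζ ^ 2 + rotY ζ ^ 2) ^ 2 + 20 * X 2 ^ 3 * (rotX ζ ^ 2 + rotY ζ ^ 2)
          - 16 * X 2 ^ 5)]
      (dehomogenize (sexticForm s t 0) 3) ![-(rotSin ζ * m), rotCos ζ * m, 0] := by
  have hr := rotCos_sq_add_rotSin_sq hζ
  have hm0 : m ≠ 0 := by rintro rfl; simp at hm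
  have eX : eval ![-(rotSin ζ * m), rotCos ζ * m, 0] (rotX ζ) = 0 := by
    rw [eval_rotX]
    simp only [Matrix.cons_val]
    ring
  have eY : eval ![-(rotSin ζ * m), rotCos ζ * m, 0] (rotY ζ) = m := by
    rw [eval_rotY]
    simp only [Matrix.cons_val]
    linear_combination m * hr
  refine ⟨?_, ?_, ?_, ?_⟩
  · refine MvPolynomial.funext fun x => ?_
    rw [eval_dehomogenize_three]
    simp only [Matrix.cons_val, affineQuadric, map_add, map_sub, map_mul, map_pow, map_neg, map_one,
      map_ofNat, eval_C, eval_X, eval_rotX, eval_rotY]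
    rw [← rot_quintic hζ, ← rot_quadratic hζ]
    ring
  · intro i
    fin_cases i <;> simp
  · intro i
    fin_cases i
    · simp [affineQuadric]
      linear_combination hm + s * m ^ 2 * hr
    · simp [eX]
    · simp [eX]
  · have : ∀ D : ℂ, D = 5 / 4 * m ^ 3 → D ≠ 0 := fun D hD h => by
      rw [h] at hD
      simp [hm0] at hD
    apply this
    simp [Matrix.det_fin_three, affineQuadric, pderiv_rotX, pderiv_rotY, Derivation.leibniz,
      Derivation.leibniz_pow, pderiv_X, eX, eY]
    linear_combination -(5 / 4) * s * m ^ 5 * hr - 5 / 4 * m ^ 3 * hm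

/-- The cubic term is `axis_factorization`. The unit at the second square collects the terms
divisible by b² at w = 0, b being the second rotated coordinate. With Q₀ the quadric at w = 0, the
third unit comes from Q₀³ - (Q₀ + w²)³. -/
theorem isCuspForm_of_axis_point {s t d ζ : ℂ} (hd : d ^ 2 = -15)
    (hs3 : s ^ 3 = 5 * (9 + d) / 9216) (ht : t = -s * (17 + d) / 2) (hs : s ≠ 0) (hζ : ζ ^ 5 = 1) :
    IsCuspForm
      ![C (1 / 9216) * (C (441 - 31 * d) + C (333 + 21 * d) * rotX ζ
          + C (-9 + 15 * d) * rotX ζ ^ 2 + C (-45 - 5 * d) * rotX ζ ^ 3),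
        C (1 / 16) * (-10 * rotX ζ ^ 3 + 5 * rotX ζ * rotY ζ ^ 2
            - 5 * (2 * rotX ζ ^ 2 + rotY ζ ^ 2) + 20)
          - C (5 * (9 + d) / 9216) * (3 * (rotX ζ ^ 2 - C ((17 + d) / 2)) ^ 2
            + 3 * (rotX ζ ^ 2 - C ((17 + d) / 2)) * rotY ζ ^ 2 + rotY ζ ^ 4),
        -(3 * (C s * (X 0 ^ 2 + X 1 ^ 2) + C t) ^ 2
          + 3 * (C s * (X 0 ^ 2 + X 1 ^ 2) + C t) * X 2 ^ 2 + X 2 ^ 4)]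
      ![rotX ζ - C ((7 - d) / 2), rotY ζ, X 2]
      (dehomogenize (sexticForm s t 0) 2)
      ![rotCos ζ * ((7 - d) / 2), rotSin ζ * ((7 - d) / 2), 0] := by
  have hr := rotCos_sq_add_rotSin_sq hζ
  have eX : eval ![rotCos ζ * ((7 - d) / 2), rotSin ζ * ((7 - d) / 2), 0] (rotX ζ) =
      (7 - d) / 2 := by
    rw [eval_rotX]
    simp only [Matrix.cons_val]
    linear_combination (7 - d) / 2 * hr
  have eY : eval ![rotCos ζ * ((7 - d) / 2), rotSin ζ * ((7 - d) / 2), 0] (rotY ζ) = 0 := by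
    rw [eval_rotY]
    simp only [Matrix.cons_val]
    ring
  refine ⟨?_, ?_, ?_, ?_⟩
  · refine MvPolynomial.funext fun x => ?_
    rw [eval_dehomogenize_two]
    simp only [Matrix.cons_val, map_add, map_sub, map_mul, map_pow, map_neg,
      map_ofNat, eval_C, eval_X, eval_rotX, eval_rotY]
    rw [← rot_quintic hζ, ← rot_quadratic hζ]
    generalize rotCos ζ * x 0 + rotSin ζ * x 1 = a
    generalize -rotSin ζ * x 0 + rotCos ζ * x 1 = b
    have h := axis_factorization hd a
    unfold axisCofactor at h
    rw [ht]
    linear_combination h / 16 - (a ^ 2 + b ^ 2 - (17 + d) / 2) ^ 3 * hs3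
  · intro i
    fin_cases i
    · simp only [Fin.zero_eta, Matrix.cons_val, map_add, map_mul, map_pow, eval_C, eX]
      convert axisCofactor_ne_zero hd using 1
      unfold axisCofactor
      ring
    · simp only [Fin.mk_one, Matrix.cons_val, map_add, map_mul, map_sub, map_pow, map_neg,
        map_ofNat, eval_C, eX, eY]
      convert axis_transversal_ne_zero hd using 1
      ring
    · simp only [Fin.reduceFinMk, Matrix.cons_val, map_add, map_mul, map_pow, map_neg,
        map_ofNat, eval_C, eval_X]
      have h1 : s * ((rotCos ζ * ((7 - d) / 2)) ^ 2 + (rotSin ζ * ((7 - d) / 2)) ^ 2) + t =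
          -4 * s * d := by
        rw [ht]
        linear_combination s * ((7 - d) / 2) ^ 2 * hr + s / 4 * hd
      rw [h1]
      have hd0 : d ≠ 0 := by rintro rfl; norm_num at hd
      simp [hs, hd0]
  · intro i
    fin_cases i
    · simp [eX]
    · simpa using eY
    · simp
  · have : ∀ D : ℂ, D = 1 → D ≠ 0 := fun D hD h => by
      rw [h] at hD
      norm_num at hD
    apply this
    simp [Matrix.det_fin_three, pderiv_rotX, pderiv_rotY, pderiv_X]
    linear_combination hr

theorem IsBaseVector.hasTypeA_and_milnorNumber {s t d ζ : ℂ} {e : Fin 4 → ℂ}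
    (he : IsBaseVector s d e) (hd : d ^ 2 = -15) (hs3 : s ^ 3 = 5 * (9 + d) / 9216)
    (ht : t = -s * (17 + d) / 2) (hs : s ≠ 0) (hζ : ζ ^ 5 = 1) (hne : rotVector ζ e ≠ 0) :
    HasTypeA 2 (sexticForm s t 0) (Projectivization.mk ℂ _ hne) ∧
      milnorNumber (sexticForm s t 0) (Projectivization.mk ℂ _ hne) = 2 := by
  rcases he with ⟨hy, hz, hq, hw⟩ | ⟨hx, hy, hz, hw⟩ | ⟨hx, hy, hz, hw⟩
  · have hw0 : e 3 ≠ 0 := fun h => by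
      rw [h, zero_pow two_ne_zero, eq_comm, mul_eq_zero] at hw
      exact hw.elim (neg_ne_zero.2 hs) (sq_sub_ne_zero_of_quadratic hd hq)
    have hF := isCuspForm_of_double_point (s := s) (t := t) (m := 1 / e 3) hζ hq (by
      field_simp
      rw [hw, ht]
      ring)
    refine hasTypeA_and_milnorNumber_mk hne (i := 3) hw0 (fun j hj => ?_) hF fun k => ?_
    · exact absurd (Fin.le_last j) (not_le.2 hj)
    · fin_cases k
      · change (rotCos ζ * e 0 - rotSin ζ * e 1) / e 3 = rotCos ζ * e 0 * (1 / e 3)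
        rw [hy]; ring
      · change (rotSin ζ * e 0 + rotCos ζ * e 1) / e 3 = rotSin ζ * e 0 * (1 / e 3)
        rw [hy]; ring
      · change e 2 / e 3 = 1 / e 3
        rw [hz]
  · have hF := isCuspForm_of_axis_point hd hs3 ht hs hζ
    refine hasTypeA_and_milnorNumber_mk hne (i := 2) ?_ (fun j hj => ?_) hF fun k => ?_
    · change e 2 ≠ 0
      rw [hz]
      exact one_ne_zero
    · have : j = 3 := by omega
      rw [this]
      exact hw
    · fin_cases k
      · change (rotCos ζ * e 0 - rotSin ζ * e 1) / e 2 = rotCos ζ * ((7 - d) / 2)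
        rw [hx, hy, hz]; ring
      · change (rotSin ζ * e 0 + rotCos ζ * e 1) / e 2 = rotSin ζ * ((7 - d) / 2)
        rw [hx, hy, hz]; ring
      · change e 3 / e 2 = 0
        rw [hw, zero_div]
  · have hw0 : e 3 ≠ 0 := fun h => by
      rw [h, zero_pow two_ne_zero, eq_comm] at hw
      exact neg_ne_zero.2 hs hw
    have hF := isCuspForm_of_infinite_double_point (s := s) (t := t) (m := 1 / e 3) hζ (by
      field_simp
      rw [hw]
      ring)
    refine hasTypeA_and_milnorNumber_mk hne (i := 3) hw0 (fun j hj => ?_) hF fun k => ?_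
    · exact absurd (Fin.le_last j) (not_le.2 hj)
    · fin_cases k
      · change (rotCos ζ * e 0 - rotSin ζ * e 1) / e 3 = -(rotSin ζ * (1 / e 3))
        rw [hx, hy]; ring
      · change (rotSin ζ * e 0 + rotCos ζ * e 1) / e 3 = rotCos ζ * (1 / e 3)
        rw [hx, hy]; ring
      · change e 2 / e 3 = 0
        rw [hz, zero_div]

/-! ### Counting the singular points -/

theorem ncard_isBaseVector {s d : ℂ} (hd : d ^ 2 = -15) (hs : s ≠ 0) :
    {e | IsBaseVector s d e}.ncard = 7 := by
  obtain ⟨r, hr⟩ := IsAlgClosed.exists_pow_nat_eq (5 : ℂ) two_pos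
  have hr0 : r ≠ 0 := by rintro rfl; norm_num at hr
  have hq1 : (1 + r) ^ 2 - 2 * (1 + r) - 4 = 0 := by linear_combination hr
  have hq2 : (1 - r) ^ 2 - 2 * (1 - r) - 4 = 0 := by linear_combination hr
  have hw : ∀ z : ℂ, z ≠ 0 → ∃ w, w ≠ 0 ∧ w ^ 2 = z := fun z hz => by
    obtain ⟨w, hw⟩ := IsAlgClosed.exists_pow_nat_eq z two_pos
    exact ⟨w, by rintro rfl; exact hz (by rw [← hw]; ring), hw⟩
  obtain ⟨a, ha0, ha⟩ := hw _ (mul_ne_zero (neg_ne_zero.2 hs) (sq_sub_ne_zero_of_quadratic hd hq1))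
  obtain ⟨b, hb0, hb⟩ := hw _ (mul_ne_zero (neg_ne_zero.2 hs) (sq_sub_ne_zero_of_quadratic hd hq2))
  obtain ⟨c, hc0, hc⟩ := hw _ (neg_ne_zero.2 hs)
  have hset : {e | IsBaseVector s d e} = (({![1 + r, 0, 1, a], ![1 + r, 0, 1, -a],
      ![1 - r, 0, 1, b], ![1 - r, 0, 1, -b], ![(7 - d) / 2, 0, 1, 0], ![0, 1, 0, c],
      ![0, 1, 0, -c]} : Finset (Fin 4 → ℂ)) : Set (Fin 4 → ℂ)) := by
    ext e
    have hext : ∀ x y z w : ℂ, e = ![x, y, z, w] ↔ e 0 = x ∧ e 1 = y ∧ e 2 = z ∧ e 3 = w :=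
      fun x y z w => by
        simp [funext_iff, Fin.forall_fin_succ]
    simp only [Finset.coe_insert, Finset.coe_singleton, Set.mem_insert_iff,
      Set.mem_singleton_iff, hext, Set.mem_ofPred_eq, IsBaseVector]
    constructor
    · rintro (⟨hy, hz, hq, hw⟩ | ⟨hx, hy, hz, hw⟩ | ⟨hx, hy, hz, hw⟩)
      · have h1 : (e 0 - (1 + r)) * (e 0 - (1 - r)) = 0 := by linear_combination hq - hr
        rcases mul_eq_zero.1 h1 with h2 | h2 <;> rw [sub_eq_zero] at h2
        · rw [h2, ← ha, sq_eq_sq_iff_eq_or_eq_neg] at hw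
          exact hw.elim (fun h => Or.inl ⟨h2, hy, hz, h⟩)
            fun h => Or.inr (Or.inl ⟨h2, hy, hz, h⟩)
        · rw [h2, ← hb, sq_eq_sq_iff_eq_or_eq_neg] at hw
          exact hw.elim (fun h => Or.inr (Or.inr (Or.inl ⟨h2, hy, hz, h⟩)))
            fun h => Or.inr (Or.inr (Or.inr (Or.inl ⟨h2, hy, hz, h⟩)))
      · exact Or.inr (Or.inr (Or.inr (Or.inr (Or.inl ⟨hx, hy, hz, hw⟩))))
      · rw [← hc, sq_eq_sq_iff_eq_or_eq_neg] at hw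
        exact hw.elim
          (fun h => Or.inr (Or.inr (Or.inr (Or.inr (Or.inr (Or.inl ⟨hx, hy, hz, h⟩))))))
          fun h => Or.inr (Or.inr (Or.inr (Or.inr (Or.inr (Or.inr ⟨hx, hy, hz, h⟩)))))
    · rintro (⟨hx, hy, hz, hw⟩ | ⟨hx, hy, hz, hw⟩ | ⟨hx, hy, hz, hw⟩ | ⟨hx, hy, hz, hw⟩ |
        ⟨hx, hy, hz, hw⟩ | ⟨hx, hy, hz, hw⟩ | ⟨hx, hy, hz, hw⟩)
      · exact Or.inl ⟨hy, hz, by rw [hx, hq1], by rw [hx, hw, ha]⟩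
      · exact Or.inl ⟨hy, hz, by rw [hx, hq1], by rw [hx, hw, neg_sq, ha]⟩
      · exact Or.inl ⟨hy, hz, by rw [hx, hq2], by rw [hx, hw, hb]⟩
      · exact Or.inl ⟨hy, hz, by rw [hx, hq2], by rw [hx, hw, neg_sq, hb]⟩
      · exact Or.inr (Or.inl ⟨hx, hy, hz, hw⟩)
      · exact Or.inr (Or.inr ⟨hx, hy, hz, by rw [hw, hc]⟩)
      · exact Or.inr (Or.inr ⟨hx, hy, hz, by rw [hw, neg_sq, hc]⟩)
  have hrr : 1 + r ≠ 1 - r := fun h => hr0 (by linear_combination h / 2)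
  rw [hset, Set.ncard_coe_finset]
  repeat rw [Finset.card_insert_of_notMem
    (by simp [Matrix.vecCons_inj, hrr, ha0, hb0, hc0, self_eq_neg])]
  rw [Finset.card_singleton]

theorem ncard_pow_five_eq_one : {ζ : ℂ | ζ ^ 5 = 1}.ncard = 5 := by
  have h := (Complex.isPrimitiveRoot_exp 5 (by norm_num)).card_nthRootsFinset
  rw [← Set.ncard_coe_finset] at h
  refine Eq.trans (congrArg Set.ncard ?_) h
  ext ζ
  simp

/-- For z = 1 the scalar is 1, and the axis coordinates agree because both their squares and their
fifth powers do. For z = 0 the scalar satisfies c⁵ = 1 and c² = 1, so again c = 1. -/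
theorem rotVector_injective {s d : ℂ} (hs : s ≠ 0) {ζ ζ' c : ℂ} {e e' : Fin 4 → ℂ}
    (hζ : ζ ^ 5 = 1) (hζ' : ζ' ^ 5 = 1) (he : IsBaseVector s d e) (he' : IsBaseVector s d e')
    (hd : d ^ 2 = -15)
    (hc : c ≠ 0) (h : rotVector ζ e = c • rotVector ζ' e') : ζ = ζ' ∧ e = e' := by
  have hI := Complex.I_sq
  have h0 : rotCos ζ * e 0 - rotSin ζ * e 1 = c * (rotCos ζ' * e' 0 - rotSin ζ' * e' 1) :=
    congrFun h 0
  have h1 : rotSin ζ * e 0 + rotCos ζ * e 1 = c * (rotSin ζ' * e' 0 + rotCos ζ' * e' 1) :=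
    congrFun h 1
  have h2 : e 2 = c * e' 2 := congrFun h 2
  have h3 : e 3 = c * e' 3 := congrFun h 3
  have hsimp : ∀ {e}, IsBaseVector s d e → (e 1 = 0 ∧ e 2 = 1 ∧ e 0 ≠ 0) ∨
      (e 0 = 0 ∧ e 1 = 1 ∧ e 2 = 0 ∧ e 3 ^ 2 = -s) := by
    rintro e (⟨hy, hz, hq, -⟩ | ⟨hx, hy, hz, -⟩ | h)
    · refine Or.inl ⟨hy, hz, fun hx => ?_⟩
      rw [hx] at hq
      norm_num at hq
    · refine Or.inl ⟨hy, hz, fun h => ?_⟩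
      rw [hx] at h
      have : d = 7 := by linear_combination -2 * h
      rw [this] at hd
      norm_num at hd
    · exact Or.inr h
  have p1 := rotCos_add_I_mul_rotSin ζ
  have p2 := rotCos_sub_I_mul_rotSin ζ
  have p1' := rotCos_add_I_mul_rotSin ζ'
  have p2' := rotCos_sub_I_mul_rotSin ζ'
  have hext : e 0 = e' 0 → e 1 = e' 1 → e 2 = e' 2 → e 3 = e' 3 → e = e' := fun a b c d => by
    funext i
    fin_cases i <;> assumption
  rcases hsimp he with ⟨hy, hz, hx⟩ | ⟨hx, hy, hz, hw⟩ <;>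
    rcases hsimp he' with ⟨hy', hz', hx'⟩ | ⟨hx', hy', hz', hw'⟩
  · have hc1 : c = 1 := by rw [hz, hz', mul_one] at h2; exact h2.symm
    rw [hc1, one_mul] at h3
    rw [hc1, hy, hy'] at h0 h1
    have ea : ζ * e 0 = ζ' * e' 0 := by
      linear_combination h0 + Complex.I * h1 - e 0 * p1 + e' 0 * p1'
    have eb : ζ ^ 4 * e 0 = ζ' ^ 4 * e' 0 := by
      linear_combination h0 - Complex.I * h1 - e 0 * p2 + e' 0 * p2'
    have e5 : e 0 ^ 5 = e' 0 ^ 5 := by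
      calc e 0 ^ 5 = (ζ * e 0) ^ 5 := by rw [mul_pow, hζ, one_mul]
        _ = e' 0 ^ 5 := by rw [ea, mul_pow, hζ', one_mul]
    have e2 : e 0 ^ 2 = e' 0 ^ 2 := by
      calc e 0 ^ 2 = (ζ * e 0) * (ζ ^ 4 * e 0) := by linear_combination -e 0 ^ 2 * hζ
        _ = e' 0 ^ 2 := by rw [ea, eb]; linear_combination e' 0 ^ 2 * hζ'
    have e1 : e 0 = e' 0 := mul_left_cancel₀ (pow_ne_zero 4 hx) (by
      linear_combination e5 - e' 0 * (e 0 ^ 2 + e' 0 ^ 2) * e2)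
    rw [← e1] at ea
    exact ⟨mul_right_cancel₀ hx ea, hext e1 (hy.trans hy'.symm) (hz.trans hz'.symm) h3⟩
  · rw [hz, hz', mul_zero] at h2
    exact absurd h2 one_ne_zero
  · rw [hz, hz', mul_one] at h2
    exact absurd h2.symm hc
  · rw [hx, hx', hy, hy'] at h0 h1
    have ea : ζ = c * ζ' := by
      linear_combination h1 - Complex.I * h0 - p1 + c * p1'
    have ec5 : c ^ 5 = 1 := by
      rw [ea, mul_pow, hζ', mul_one] at hζ
      exact hζ
    have ec2 : c ^ 2 = 1 := by
      rw [h3, mul_pow, hw'] at hw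
      exact mul_right_cancel₀ (neg_ne_zero.2 hs) (by rw [hw, one_mul])
    have hc1 : c = 1 := by linear_combination ec5 - c * (c ^ 2 + 1) * ec2
    rw [hc1, one_mul] at ea h3
    exact ⟨ea, hext (hx.trans hx'.symm) (hy.trans hy'.symm) (hz.trans hz'.symm) h3⟩

/-- The singular point attached to a fifth root of unity and a base vector. -/
noncomputable def rotPoint {s d : ℂ}
    (p : ({ζ : ℂ | ζ ^ 5 = 1} ×ˢ {e | IsBaseVector s d e} : Set (ℂ × (Fin 4 → ℂ)))) : P3 :=
  Projectivization.mk ℂ (rotVector p.1.1 p.1.2) (IsBaseVector.rotVector_ne_zero p.2.2 p.2.1)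

theorem rotPoint_injective {s d : ℂ} (hd : d ^ 2 = -15) (hs : s ≠ 0) :
    Function.Injective (rotPoint (s := s) (d := d)) := by
  intro p q h
  obtain ⟨c, hc⟩ := (Projectivization.mk_eq_mk_iff _ _ _ _ _).1 h
  obtain ⟨h1, h2⟩ := rotVector_injective hs p.2.1 q.2.1 p.2.2 q.2.2 hd c.ne_zero hc.symm
  exact Subtype.ext (Prod.ext h1 h2)

theorem singularPoints_eq_range {s t d : ℂ} (hd : d ^ 2 = -15)
    (hs3 : s ^ 3 = 5 * (9 + d) / 9216) (ht : t = -s * (17 + d) / 2) :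
    singularPoints (sexticForm s t 0) = Set.range (rotPoint (s := s) (d := d)) := by
  ext P
  constructor
  · intro hP
    induction P using Projectivization.ind with | h v hv =>
    rw [mk_mem_singularPoints_iff hv] at hP
    obtain ⟨ζ, e, hζ, he, c, hc, hp⟩ := hP.exists_rotVector hd hs3 ht hv
    exact ⟨⟨(ζ, e), hζ, he⟩, ((Projectivization.mk_eq_mk_iff' _ _ _ _ _).2 ⟨c, hp.symm⟩).symm⟩
  · rintro ⟨p, rfl⟩
    exact (mk_mem_singularPoints_iff _).2 (IsBaseVector.isSingularVector p.2.2 hd hs3 ht p.2.1)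

/-! ### The parameter equation and conclusion -/

theorem im_ne_zero_of_isSpecialParameter {s : ℂ} (h : IsSpecialParameter s) : s.im ≠ 0 := by
  intro him
  obtain ⟨r, rfl⟩ : ∃ r : ℝ, s = r := ⟨s.re, Complex.ext rfl him⟩
  unfold IsSpecialParameter at h
  have h2 : (2 : ℝ) ^ 15 * 3 ^ 3 * r ^ 6 - 2 ^ 6 * 3 ^ 3 * 5 * r ^ 3 + 5 ^ 2 = 0 := by
    exact_mod_cast h
  -- The square is (5d)², which the equation forces to be -375.
  nlinarith [sq_nonneg (9216 * r ^ 3 - 45)]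

open Polynomial in
theorem ncard_isSpecialParameter : {s : ℂ | IsSpecialParameter s}.ncard = 6 := by
  set p : ℂ[X] := Polynomial.C 884736 * Polynomial.X ^ 6 - Polynomial.C 8640 * Polynomial.X ^ 3
    + Polynomial.C 25 with hp
  have hdeg : p.natDegree = 6 := by
    rw [hp]
    compute_degree!
  have hp0 : p ≠ 0 := fun h => by simp [h] at hdeg
  have hsep : p.Separable := by
    -- Bézout coefficients for `p` and its derivative.
    refine ⟨Polynomial.C (1 / 25) + Polynomial.C (27648 / 625) * Polynomial.X ^ 3,
      Polynomial.C (11 / 375) * Polynomial.X - Polynomial.C (4608 / 625) * Polynomial.X ^ 4, ?_⟩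
    refine Polynomial.funext fun x => ?_
    simp [hp]
    ring
  have h := Polynomial.card_rootSet_eq_natDegree (K := ℂ) hsep (IsAlgClosed.splits _)
  rw [← Nat.card_eq_fintype_card, Nat.card_coe_set_eq, hdeg] at h
  rw [← h]
  congr 1
  ext s
  rw [Polynomial.mem_rootSet]
  simp only [Set.mem_ofPred_eq, IsSpecialParameter, hp0, ne_eq, not_false_eq_true, true_and]
  simp [hp]
  norm_num

theorem theorem1 :
    ({s : ℂ | IsSpecialParameter s}.ncard = 6 ∧ ∀ s : ℂ, IsSpecialParameter s → s.im ≠ 0) ∧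
    ∀ s₀ t₀ : ℂ, IsSpecialParameter s₀ →
      t₀ = -4 * s₀ * (2 ^ 7 * 3 ^ 2 / 5 * s₀ ^ 3 + 1) →
      (singularPoints (sexticForm s₀ t₀ 0)).ncard = 35 ∧
      (∀ P ∈ singularPoints (sexticForm s₀ t₀ 0), HasTypeA 2 (sexticForm s₀ t₀ 0) P) ∧
      totalMilnorNumber (sexticForm s₀ t₀ 0) = 70 := by
  refine ⟨⟨ncard_isSpecialParameter, fun s => im_ne_zero_of_isSpecialParameter⟩, ?_⟩
  intro s t hspec ht'
  obtain ⟨d, hd, hs3, ht, hs⟩ := exists_sqrt_of_isSpecialParameter hspec ht'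
  have hrange := singularPoints_eq_range hd hs3 ht
  have hcard : (singularPoints (sexticForm s t 0)).ncard = 35 := by
    rw [hrange, ← Nat.card_coe_set_eq, Nat.card_range_of_injective (rotPoint_injective hd hs),
      Nat.card_coe_set_eq, Set.ncard_prod, ncard_pow_five_eq_one, ncard_isBaseVector hd hs]
  have hlocal : ∀ P ∈ singularPoints (sexticForm s t 0),
      HasTypeA 2 (sexticForm s t 0) P ∧ milnorNumber (sexticForm s t 0) P = 2 := by
    rw [hrange]
    rintro _ ⟨p, rfl⟩
    exact IsBaseVector.hasTypeA_and_milnorNumber p.2.2 hd hs3 ht hs p.2.1 _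
  refine ⟨hcard, fun P hP => (hlocal P hP).1, ?_⟩
  have hfin : (singularPoints (sexticForm s t 0)).Finite :=
    Set.finite_of_ncard_ne_zero (by rw [hcard]; norm_num)
  have := hfin.fintype
  rw [totalMilnorNumber, tsum_fintype, Finset.sum_congr rfl fun P _ => (hlocal P.1 P.2).2,
    Finset.sum_const, Finset.card_univ, ← Nat.card_eq_fintype_card, Nat.card_coe_set_eq, hcard]
  norm_num
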